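/- Conventions. An exact category $(\mathcal A,\mathcal E)$ is an additive category with an exact structure in the sense of Quillen; the members of $\mathcal E$ are called conflations, and their first (second) maps inflations (deflations). It is Frobenius if it has enough projectives and enough injectives and the projectives coincide with the injectives. A functor between exact categories is exact if it is additive and sends conflations to conflations; an exact equivalence is an exact functor that is an equivalence of categories and whose quasi-inverse is also exact. For a full additive subcategory $\mathcal F\subseteq\mathcal A$, let $[\mathcal F]$ be the ideal of morphisms factoring through objects of $\mathcal F$ and $\pi_{\mathcal F}\colon\mathcal A\to\mathcal A/[\mathcal F]$ the canonical functor. If $\mathcal A$ is Frobenius, $\mathcal F$ is removable if it consists of projective objects and $\pi_{\mathcal F}$ sends conflations to kernel-cokernel pairs; then $\mathcal A/[\mathcal F]$ carries the exact structure given by the isomorphism closure of $\pi_{\mathcal F}(\mathcal E)$. An additive functor $F\colon\mathcal A\to\mathcal B$ between Frobenius categories is a Frobenius quotient if it factors as $\mathcal A\xrightarrow{\pi_{\mathcal F}}\mathcal A/[\mathcal F]\xrightarrow{\bar F}\mathcal B$ with $\mathcal F$ removable and $\bar F$ an exact equivalence; such an $F$ is exact. Its essential kernel ${\rm Ker}(F)$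 is the full subcategory of objects $X$ with $F(X)\simeq 0$. For $n\ge 1$, ${\rm Inf}_n(\mathcal A)$ is the category of sequences $X^1\to X^2\to\cdots\to X^n$ of $n-1$ composable inflations in $\mathcal A$, with commutative ladders as morphisms; its conflations are the sequences that are conflations in each component. An exact functor $F\colon\mathcal A\to\mathcal B$ induces ${\rm Inf}_n(F)\colon{\rm Inf}_n(\mathcal A)\to{\rm Inf}_n(\mathcal B)$ componentwise. For $1\le j\le n$ and an object $P$ of $\mathcal A$, $\theta^j(P)=(0\to\cdots\to 0\to P\xrightarrow{\rm Id}P\to\cdots\xrightarrow{\rm Id}P)$ with $j-1$ zeros. By ${\rm add}\,\mathcal S$ we denote the smallest full additive subcategory that contains $\mathcal S$ and is closed under direct summands (and isomorphisms). Theorem. Let $F\colon\mathcal A\to\mathcal B$ be a Frobenius quotient between two Frobenius exact categories. Then for every $n\ge 1$, the categories ${\rm Inf}_n(\mathcal A)$ and ${\rm Inf}_n(\mathcal B)$ are Frobenius exact categories, the induced functor ${\rm Inf}_n(F)\colon{\rm Inf}_n(\mathcal A)\to{\rm Inf}_n(\mathcal B)$ is again a Frobenius quotient, and its essential kernel equals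 ${\rm add}\{\theta^j(P)\mid 1\le j\le n,\ P\in{\rm Ker}(F)\}$. -/

import Mathlib

open CategoryTheory CategoryTheory.Limits

namespace FrobQuot

universe v u v' u'

/-! ### Exact categories -/

section Exact

variable {C : Type u} [Category.{v} C] [Preadditive C]

/-- `X ⟶ Y ⟶ Z` is a kernel-cokernel pair: the first map is a kernel of the second one
and the second map is a cokernel of the first one. -/
def IsKernelCokernelPair (S : ShortComplex C) : Prop :=
  Nonempty (IsLimit (KernelFork.ofι S.f S.zero)) ∧
    Nonempty (IsColimit (CokernelCofork.ofπ S.g S.zero))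

/-- A morphism is an inflation for a class `E` of short complexes if it is the first map of a
member of `E`. -/
def IsInflation (E : ObjectProperty (ShortComplex C)) {X Y : C} (f : X ⟶ Y) : Prop :=
  ∃ (Z : C) (g : Y ⟶ Z) (w : f ≫ g = 0), E (ShortComplex.mk f g w)

/-- A morphism is a deflation for a class `E` of short complexes if it is the second map of a
member of `E`. -/
def IsDeflation (E : ObjectProperty (ShortComplex C)) {Y Z : C} (g : Y ⟶ Z) : Prop :=
  ∃ (X : C) (f : X ⟶ Y) (w : f ≫ g = 0), E (ShortComplex.mk f g w)

/-- `(C, E)` is an exact category in the sense of Quillen: `C` is an additive category and `E`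
is a class of kernel-cokernel pairs, closed under isomorphisms, satisfying the axioms of an
exact structure. The members of `E` are the conflations. -/
structure IsExactCategory (E : ObjectProperty (ShortComplex C)) : Prop where
  hasZeroObject : HasZeroObject C
  hasBinaryBiproducts : HasBinaryBiproducts C
  kernelCokernel : ∀ S, E S → IsKernelCokernelPair S
  of_iso : ∀ {S T : ShortComplex C}, (S ≅ T) → E S → E T
  inflation_id : ∀ X : C, IsInflation E (𝟙 X)
  deflation_id : ∀ X : C, IsDeflation E (𝟙 X)
  inflation_comp : ∀ {X Y Z : C} (f : X ⟶ Y) (g : Y ⟶ Z),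
    IsInflation E f → IsInflation E g → IsInflation E (f ≫ g)
  deflation_comp : ∀ {X Y Z : C} (f : X ⟶ Y) (g : Y ⟶ Z),
    IsDeflation E f → IsDeflation E g → IsDeflation E (f ≫ g)
  inflation_pushout : ∀ {X Y X' : C} (f : X ⟶ Y) (a : X ⟶ X'), IsInflation E f →
    ∃ (Y' : C) (b : Y ⟶ Y') (f' : X' ⟶ Y'), IsPushout f a b f' ∧ IsInflation E f'
  deflation_pullback : ∀ {Y Z Z' : C} (g : Y ⟶ Z) (c : Z' ⟶ Z), IsDeflation E g →
    ∃ (Y' : C) (b : Y' ⟶ Y) (g' : Y' ⟶ Z'), IsPullback b g' g c ∧ IsDeflation E g'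

/-- The projective objects of an exact category: morphisms out of them lift through
deflations. -/
def proj (E : ObjectProperty (ShortComplex C)) : ObjectProperty C := fun P =>
  ∀ ⦃Y Z : C⦄ (g : Y ⟶ Z), IsDeflation E g → ∀ h : P ⟶ Z, ∃ k : P ⟶ Y, k ≫ g = h

/-- The injective objects of an exact category: morphisms into them extend along inflations. -/
def inj (E : ObjectProperty (ShortComplex C)) : ObjectProperty C := fun I =>
  ∀ ⦃X Y : C⦄ (f : X ⟶ Y), IsInflation E f → ∀ h : X ⟶ I, ∃ k : Y ⟶ I, f ≫ k = h

/-- `(C, E)` is a Frobenius (exact) category. -/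
structure IsFrobeniusCategory (E : ObjectProperty (ShortComplex C)) : Prop
    extends IsExactCategory E where
  enough_proj : ∀ X : C, ∃ (P : C) (p : P ⟶ X), proj E P ∧ IsDeflation E p
  enough_inj : ∀ X : C, ∃ (I : C) (i : X ⟶ I), inj E I ∧ IsInflation E i
  proj_iff_inj : ∀ X : C, proj E X ↔ inj E X

end Exact

/-! ### Functors between exact categories -/

section Functors

variable {C : Type u} [Category.{v} C] [Preadditive C]
  {D : Type u'} [Category.{v'} D] [Preadditive D]

/-- The additive functor `F` is exact: it sends conflations to conflations. -/
def IsExactFunctor (E : ObjectProperty (ShortComplex C)) (E' : ObjectProperty (ShortComplex D))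
    (F : C ⥤ D) [F.Additive] : Prop :=
  ∀ S : ShortComplex C, E S → E' (S.map F)

/-- `F` is an exact equivalence: an equivalence of categories such that both `F` and its
quasi-inverse are exact. -/
def IsExactEquivalence (E : ObjectProperty (ShortComplex C))
    (E' : ObjectProperty (ShortComplex D)) (F : C ⥤ D) [F.Additive] : Prop :=
  IsExactFunctor E E' F ∧ ∃ (H : D ⥤ C) (_ : H.Additive),
    Nonempty (F ⋙ H ≅ 𝟭 C) ∧ Nonempty (H ⋙ F ≅ 𝟭 D) ∧ IsExactFunctor E' E H

/-- The essential kernel of `F`: the objects annihilated by `F`. -/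
def essKer (F : C ⥤ D) : ObjectProperty C := fun X => IsZero (F.obj X)

end Functors

/-! ### Factor categories -/

section Quotients

variable {C : Type u} [Category.{v} C] [Preadditive C]

/-- The full subcategory given by `𝓕` is an additive subcategory: it contains a zero object and
any two of its objects have a direct sum in it. -/
class IsAdditiveSubcategory (𝓕 : ObjectProperty C) : Prop where
  zero : ∃ Z : C, IsZero Z ∧ 𝓕 Z
  sum : ∀ X Y : C, 𝓕 X → 𝓕 Y → ∃ b : BinaryBicone X Y, Nonempty b.IsBilimit ∧ 𝓕 b.pt

/-- `f` factors through an object of `𝓕`, that is, `f` belongs to the ideal `[𝓕]`. -/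
def FactorsThrough (𝓕 : ObjectProperty C) {X Y : C} (f : X ⟶ Y) : Prop :=
  ∃ (W : C) (a : X ⟶ W) (b : W ⟶ Y), 𝓕 W ∧ a ≫ b = f

/-- Two parallel morphisms are identified if their difference belongs to `[𝓕]`. -/
def idealRel (𝓕 : ObjectProperty C) : HomRel C := fun _ _ f g => FactorsThrough 𝓕 (f - g)

lemma FactorsThrough.add {𝓕 : ObjectProperty C} [IsAdditiveSubcategory 𝓕] {X Y : C}
    {f g : X ⟶ Y} (hf : FactorsThrough 𝓕 f) (hg : FactorsThrough 𝓕 g) :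
    FactorsThrough 𝓕 (f + g) := by
  obtain ⟨W, a, b, hW, rfl⟩ := hf
  obtain ⟨V, c, d, hV, rfl⟩ := hg
  obtain ⟨B, -, hB⟩ := IsAdditiveSubcategory.sum W V hW hV
  exact ⟨B.pt, a ≫ B.inl + c ≫ B.inr, B.fst ≫ b + B.snd ≫ d, hB, by simp⟩

lemma FactorsThrough.neg {𝓕 : ObjectProperty C} {X Y : C} {f : X ⟶ Y}
    (hf : FactorsThrough 𝓕 f) : FactorsThrough 𝓕 (-f) := by
  obtain ⟨W, a, b, hW, rfl⟩ := hf
  exact ⟨W, -a, b, hW, by simp⟩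

instance (𝓕 : ObjectProperty C) [IsAdditiveSubcategory 𝓕] : Congruence (idealRel 𝓕) where
  comp_left := by
    rintro X Y Z f g g' ⟨W, a, b, hW, h⟩
    exact ⟨W, f ≫ a, b, hW, by simp [h]⟩
  comp_right := by
    rintro X Y Z f f' g ⟨W, a, b, hW, h⟩
    exact ⟨W, a, b ≫ g, hW, by rw [← Category.assoc, h, Preadditive.sub_comp]⟩
  equivalence :=
    { refl := fun f => by
        obtain ⟨Z, -, hZ⟩ := IsAdditiveSubcategory.zero (𝓕 := 𝓕)
        exact ⟨Z, 0, 0, hZ, by simp⟩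
      symm := fun h => by simpa [idealRel] using FactorsThrough.neg h
      trans := fun h h' => by simpa [idealRel] using FactorsThrough.add h h' }

lemma idealRel_add (𝓕 : ObjectProperty C) [IsAdditiveSubcategory 𝓕] ⦃X Y : C⦄
    (f₁ f₂ g₁ g₂ : X ⟶ Y) (h : idealRel 𝓕 f₁ f₂) (h' : idealRel 𝓕 g₁ g₂) :
    idealRel 𝓕 (f₁ + g₁) (f₂ + g₂) := by
  have := FactorsThrough.add h h'
  rwa [← add_sub_add_comm] at this

/-- The factor category `C/[𝓕]`. -/
abbrev FactorCategory (𝓕 : ObjectProperty C) := Quotient (idealRel 𝓕)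

instance (𝓕 : ObjectProperty C) [IsAdditiveSubcategory 𝓕] : Preadditive (FactorCategory 𝓕) :=
  Quotient.preadditive (idealRel 𝓕) (idealRel_add 𝓕)

/-- The canonical functor `C ⥤ C/[𝓕]`. -/
abbrev factorFunctor (𝓕 : ObjectProperty C) : C ⥤ FactorCategory 𝓕 :=
  Quotient.functor (idealRel 𝓕)

instance (𝓕 : ObjectProperty C) [IsAdditiveSubcategory 𝓕] : (factorFunctor 𝓕).Additive :=
  Quotient.functor_additive (idealRel 𝓕) (idealRel_add 𝓕)

/-- The conflations of `C/[𝓕]`: the isomorphism closure of the image of the conflations of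
`C`. -/
def factorConflation (E : ObjectProperty (ShortComplex C)) (𝓕 : ObjectProperty C)
    [IsAdditiveSubcategory 𝓕] : ObjectProperty (ShortComplex (FactorCategory 𝓕)) := fun T =>
  ∃ S : ShortComplex C, E S ∧ Nonempty (S.map (factorFunctor 𝓕) ≅ T)

/-- The additive subcategory `𝓕` of the Frobenius category `(C, E)` is removable. -/
structure IsRemovable (E : ObjectProperty (ShortComplex C)) (𝓕 : ObjectProperty C)
    [IsAdditiveSubcategory 𝓕] : Prop where
  le_proj : ∀ X : C, 𝓕 X → proj E X
  kernelCokernel : ∀ S : ShortComplex C, E S → IsKernelCokernelPair (S.map (factorFunctor 𝓕))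

variable {D : Type u'} [Category.{v'} D] [Preadditive D]

/-- The additive functor `F` between Frobenius categories is a Frobenius quotient: it factors as
the canonical functor `C ⥤ C/[𝓕]` for a removable subcategory `𝓕`, followed by an exact
equivalence. -/
def IsFrobeniusQuotient (E : ObjectProperty (ShortComplex C))
    (E' : ObjectProperty (ShortComplex D)) (F : C ⥤ D) : Prop :=
  ∃ (𝓕 : ObjectProperty C) (_ : IsAdditiveSubcategory 𝓕) (G : FactorCategory 𝓕 ⥤ D)
    (_ : G.Additive), IsRemovable E 𝓕 ∧ factorFunctor 𝓕 ⋙ G = F ∧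
      IsExactEquivalence (factorConflation E 𝓕) E' G

/-- A Frobenius quotient is an exact functor. -/
lemma IsFrobeniusQuotient.exact {E : ObjectProperty (ShortComplex C)}
    {E' : ObjectProperty (ShortComplex D)} {F : C ⥤ D} [F.Additive]
    (hF : IsFrobeniusQuotient E E' F) : IsExactFunctor E E' F := by
  obtain ⟨𝓕, h𝓕, G, hG, -, rfl, hex, -⟩ := hF
  intro S hS
  exact hex _ ⟨S, hS, ⟨Iso.refl _⟩⟩

end Quotients

/-! ### Additive closure -/

/-- `add S`: the smallest full additive subcategory containing `S` that is closed under direct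
summands. -/
inductive addClosure {C : Type u} [Category.{v} C] [Preadditive C] (S : ObjectProperty C) :
    ObjectProperty C
  | of (X : C) (h : S X) : addClosure S X
  | zero (X : C) (h : IsZero X) : addClosure S X
  | sum {X Y : C} (b : BinaryBicone X Y) (hb : b.IsBilimit) (hX : addClosure S X)
      (hY : addClosure S Y) : addClosure S b.pt
  | summand {X Y : C} (b : BinaryBicone X Y) (hb : b.IsBilimit) (h : addClosure S b.pt) :
      addClosure S X

/-! ### Categories of `n`-inflations -/

section Inflations

variable {C : Type u} [Category.{v} C] [Preadditive C]

/-- A sequence `X⁰ ⟶ X¹ ⟶ ⋯ ⟶ Xⁿ⁻¹` of `n` objects is an `n`-inflation if each of the `n - 1`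
maps between consecutive objects is an inflation. -/
def isNInflation (E : ObjectProperty (ShortComplex C)) (n : ℕ) : ObjectProperty (Fin n ⥤ C) :=
  fun X => ∀ (i : ℕ) (hi : i + 1 < n),
    IsInflation E (X.map (homOfLE (Nat.le_succ i) :
      (⟨i, Nat.lt_of_succ_lt hi⟩ : Fin n) ⟶ ⟨i + 1, hi⟩))

/-- The category of `n`-inflations, a full subcategory of the category of sequences of `n`
objects. -/
abbrev Inf (E : ObjectProperty (ShortComplex C)) (n : ℕ) := (isNInflation E n).FullSubcategory

/-- The functor sending an `n`-inflation to its `i`-th component. -/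
abbrev Inf.component (E : ObjectProperty (ShortComplex C)) (n : ℕ) (i : Fin n) : Inf E n ⥤ C :=
  (isNInflation E n).ι ⋙ (evaluation (Fin n) C).obj i

instance (E : ObjectProperty (ShortComplex C)) (n : ℕ) (i : Fin n) :
    (Inf.component E n i).Additive where
  map_add := rfl

/-- The conflations of the category of `n`-inflations are the sequences that are conflations in
each component. -/
def Inf.conflation (E : ObjectProperty (ShortComplex C)) (n : ℕ) :
    ObjectProperty (ShortComplex (Inf E n)) := fun S =>
  ∀ i : Fin n, E (S.map (Inf.component E n i))

variable {D : Type u'} [Category.{v'} D] [Preadditive D]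

lemma IsExactFunctor.map_inflation {E : ObjectProperty (ShortComplex C)}
    {E' : ObjectProperty (ShortComplex D)} {F : C ⥤ D} [F.Additive]
    (hF : IsExactFunctor E E' F) {X Y : C} {f : X ⟶ Y} (hf : IsInflation E f) :
    IsInflation E' (F.map f) := by
  obtain ⟨Z, g, w, h⟩ := hf
  exact ⟨F.obj Z, F.map g, by rw [← F.map_comp, w, F.map_zero], hF _ h⟩

/-- The functor between categories of `n`-inflations induced by an exact functor, which applies
the functor to each component. -/
def infFunctor {E : ObjectProperty (ShortComplex C)} {E' : ObjectProperty (ShortComplex D)}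
    (F : C ⥤ D) [F.Additive] (hF : IsExactFunctor E E' F) (n : ℕ) : Inf E n ⥤ Inf E' n :=
  (isNInflation E' n).lift ((isNInflation E n).ι ⋙ (Functor.whiskeringRight (Fin n) C D).obj F)
    (fun X i hi => hF.map_inflation (X.property i hi))

instance {E : ObjectProperty (ShortComplex C)} {E' : ObjectProperty (ShortComplex D)}
    (F : C ⥤ D) [F.Additive] (hF : IsExactFunctor E E' F) (n : ℕ) :
    (infFunctor F hF n).Additive where
  map_add {X Y f g} := by
    apply ObjectProperty.hom_ext
    ext i
    exact F.map_add

lemma IsExactCategory.inflation_eqToHom {E : ObjectProperty (ShortComplex C)}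
    (hE : IsExactCategory E) {X Y : C} (h : X = Y) : IsInflation E (eqToHom h) := by
  subst h
  exact hE.inflation_id X

lemma IsExactCategory.inflation_of_isZero {E : ObjectProperty (ShortComplex C)}
    (hE : IsExactCategory E) {X Y : C} (hX : IsZero X) (f : X ⟶ Y) : IsInflation E f := by
  obtain ⟨K, k, w, h⟩ := hE.deflation_id Y
  obtain ⟨⟨hk⟩, -⟩ := hE.kernelCokernel _ h
  have hk0 : k = 0 := by simpa using w
  have hK : IsZero K := by
    rw [IsZero.iff_id_eq_zero]
    exact Fork.IsLimit.hom_ext hk (by simp [hk0])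
  refine ⟨Y, 𝟙 Y, by rw [hX.eq_of_src f 0, zero_comp], hE.of_iso ?_ h⟩
  exact ShortComplex.isoMk (hK.iso hX) (Iso.refl _) (Iso.refl _) (hK.eq_of_src _ _) (by simp)

open ZeroObject in
/-- The sequence `0 ⟶ ⋯ ⟶ 0 ⟶ P ⟶ P ⟶ ⋯ ⟶ P` of `n` objects with `s` zeros, all maps between
copies of `P` being identities. -/
noncomputable def thetaSeq [HasZeroObject C] {n : ℕ} (s : Fin n) (P : C) : Fin n ⥤ C where
  obj i := if s ≤ i then P else 0
  map {i j} f :=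
    if h : s ≤ i then eqToHom (by rw [if_pos h, if_pos (h.trans (leOfHom f))]) else 0
  map_id i := by
    by_cases h : s ≤ i
    · simp [h]
    · rw [dif_neg h]
      apply IsZero.eq_of_src
      rw [if_neg h]
      exact isZero_zero C
  map_comp {i j k} f g := by
    by_cases h : s ≤ i
    · simp [h, h.trans (leOfHom f)]
    · simp [h]

/-- The `n`-inflation `0 ⟶ ⋯ ⟶ 0 ⟶ P ⟶ P ⟶ ⋯ ⟶ P` with `s` zeros, for `0 ≤ s ≤ n - 1`; in
one-based numbering this is `θ^{s+1}(P)`. -/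
noncomputable def theta {E : ObjectProperty (ShortComplex C)} (hE : IsExactCategory E) {n : ℕ}
    (s : Fin n) (P : C) : Inf E n :=
  haveI := hE.hasZeroObject
  { obj := thetaSeq s P
    property := fun i hi => by
      dsimp only [thetaSeq]
      split_ifs with h
      · exact hE.inflation_eqToHom _
      · apply hE.inflation_of_isZero
        rw [if_neg h]
        exact isZero_zero C }

end Inflations

end FrobQuot

universe v₁ u₁ v₂ u₂

namespace FrobQuot

universe v u v' u'

/-! ### Kernel-cokernel pairs -/

section Exact

variable {C : Type u} [Category.{v} C] [Preadditive C]

/-! Everything rests on dévissage along concentrated objects, those isomorphic to `0 ⟶ ⋯ ⟶ 0 ⟶ M ⟶ ⋯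
⟶ M` starting at a place `s`. A morphism from such an object to `Y` is the same as a morphism from
`M` to the `s`-th component of `Y`, so a question about maps out of it is a question in the base
category. If `X` vanishes before `s`, then `j ↦ X^{min(j,s)}` is a subobject concentrated at `s`,
and the quotient vanishes up to and including `s`. Iterating, every `n`-inflation is built from
concentrated ones by finitely many extensions (`Inf.devissage_of`). Each assertion is therefore
checked on concentrated objects and shown to be stable under extensions.

The category of `n`-inflations is exact because it is extension-closed in a functor category, where
conflations are componentwise. It is Frobenius because the objects with projective components are
both projective and injective, and horseshoe arguments provide enough of them.

For the quotient statement, `IsIdealQuotient` gives a description that does not involve the chosen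
removable subcategory: the functor is exact, full and essentially surjective, kills only maps
factoring through its essential kernel, that kernel consists of projectives, and conflations lift up
to isomorphism. Each of these passes to `n`-inflations. Factorizations are glued along a conflation
since objects of the kernel are also injective. Fullness on an extension follows by lifting a
section over a pushout and correcting it through the kernel. Conflations lift because every
extension of `Z` by `X` is a pushout of a conflation ending in `Z` whose middle term is projective;
essential surjectivity is a consequence.

Finally, an object of the essential kernel has all its components in `Ker(F)`. The conflations met
in its dévissage have projective right ends and split, leaving a finite direct sum of objects
`θ^j(P)`. -/

lemma IsKernelCokernelPair.of_lift_desc {S : ShortComplex C} (hf : Mono S.f) (hg : Epi S.g)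
    (lift : ∀ ⦃T : C⦄ (t : T ⟶ S.X₂), t ≫ S.g = 0 → ∃ s, s ≫ S.f = t)
    (desc : ∀ ⦃T : C⦄ (t : S.X₂ ⟶ T), S.f ≫ t = 0 → ∃ s, S.g ≫ s = t) :
    IsKernelCokernelPair S :=
  ⟨⟨KernelFork.IsLimit.ofι' S.f S.zero fun {_} t ht => ⟨_, (lift t ht).choose_spec⟩⟩,
    ⟨CokernelCofork.IsColimit.ofπ' S.g S.zero fun {_} t ht => ⟨_, (desc t ht).choose_spec⟩⟩⟩

lemma IsKernelCokernelPair.mono {S : ShortComplex C} (h : IsKernelCokernelPair S) : Mono S.f :=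
  mono_of_isLimit_fork h.1.some

lemma IsKernelCokernelPair.epi {S : ShortComplex C} (h : IsKernelCokernelPair S) : Epi S.g :=
  epi_of_isColimit_cofork h.2.some

lemma IsKernelCokernelPair.lift {S : ShortComplex C} (h : IsKernelCokernelPair S) {T : C}
    (t : T ⟶ S.X₂) (ht : t ≫ S.g = 0) : ∃ s, s ≫ S.f = t :=
  ⟨_, (KernelFork.IsLimit.lift' h.1.some t ht).2⟩

lemma IsKernelCokernelPair.desc {S : ShortComplex C} (h : IsKernelCokernelPair S) {T : C}
    (t : S.X₂ ⟶ T) (ht : S.f ≫ t = 0) : ∃ s, S.g ≫ s = t :=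
  ⟨_, (CokernelCofork.IsColimit.desc' h.2.some t ht).2⟩

/-- Fully faithful additive functors reflect kernel-cokernel pairs. -/
lemma IsKernelCokernelPair.of_map {D : Type u'} [Category.{v'} D] [Preadditive D] (L : C ⥤ D)
    [L.Additive] [L.Full] [L.Faithful] {S : ShortComplex C}
    (h : IsKernelCokernelPair (S.map L)) : IsKernelCokernelPair S := by
  have hm : Mono (L.map S.f) := h.mono
  have he : Epi (L.map S.g) := h.epi
  refine .of_lift_desc (L.mono_of_mono_map hm) (L.epi_of_epi_map he) (fun T t ht => ?_)
    (fun T t ht => ?_)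
  · obtain ⟨s, hs⟩ := h.lift (L.map t) (by
      change L.map t ≫ L.map S.g = 0
      rw [← L.map_comp, ht, L.map_zero])
    obtain ⟨s, rfl⟩ := L.map_surjective s
    exact ⟨s, L.map_injective (by rw [L.map_comp]; exact hs)⟩
  · obtain ⟨s, hs⟩ := h.desc (L.map t) (by
      change L.map S.f ≫ L.map t = 0
      rw [← L.map_comp, ht, L.map_zero])
    obtain ⟨s, rfl⟩ := L.map_surjective s
    exact ⟨s, L.map_injective (by rw [L.map_comp]; exact hs)⟩

/-! ### Conflations given by their two maps -/

/-- The maps `f` and `g` form a conflation. -/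
def IsConflation (E : ObjectProperty (ShortComplex C)) {X Y Z : C} (f : X ⟶ Y) (g : Y ⟶ Z) :
    Prop :=
  ∃ w : f ≫ g = 0, E (ShortComplex.mk f g w)

variable {E : ObjectProperty (ShortComplex C)}

lemma IsConflation.zero {X Y Z : C} {f : X ⟶ Y} {g : Y ⟶ Z} (h : IsConflation E f g) :
    f ≫ g = 0 := h.1

lemma IsConflation.inflation {X Y Z : C} {f : X ⟶ Y} {g : Y ⟶ Z} (h : IsConflation E f g) :
    IsInflation E f := ⟨Z, g, h⟩

lemma IsConflation.deflation {X Y Z : C} {f : X ⟶ Y} {g : Y ⟶ Z} (h : IsConflation E f g) :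
    IsDeflation E g := ⟨X, f, h⟩

lemma IsInflation.exists_conflation {X Y : C} {f : X ⟶ Y} (h : IsInflation E f) :
    ∃ (Z : C) (g : Y ⟶ Z), IsConflation E f g := h

lemma IsDeflation.exists_conflation {Y Z : C} {g : Y ⟶ Z} (h : IsDeflation E g) :
    ∃ (X : C) (f : X ⟶ Y), IsConflation E f g := h

namespace IsExactCategory

variable (hE : IsExactCategory E)
include hE

section

variable {X Y Z : C} {f : X ⟶ Y} {g : Y ⟶ Z}

lemma mono (h : IsConflation E f g) : Mono f := (hE.kernelCokernel _ h.2).mono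

lemma epi (h : IsConflation E f g) : Epi g := (hE.kernelCokernel _ h.2).epi

lemma lift (h : IsConflation E f g) {T : C} (t : T ⟶ Y) (ht : t ≫ g = 0) :
    ∃ s : T ⟶ X, s ≫ f = t := (hE.kernelCokernel _ h.2).lift t ht

lemma desc (h : IsConflation E f g) {T : C} (t : Y ⟶ T) (ht : f ≫ t = 0) :
    ∃ s : Z ⟶ T, g ≫ s = t := (hE.kernelCokernel _ h.2).desc t ht

lemma conflation_of_iso {X' Y' Z' : C} {f' : X' ⟶ Y'} {g' : Y' ⟶ Z'} (a : X ≅ X') (b : Y ≅ Y')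
    (c : Z ≅ Z') (h₁ : a.hom ≫ f' = f ≫ b.hom) (h₂ : b.hom ≫ g' = g ≫ c.hom)
    (h : IsConflation E f g) : IsConflation E f' g' := by
  have w : f' ≫ g' = 0 := by
    rw [← cancel_epi a.hom, reassoc_of% h₁, h₂, reassoc_of% h.1]
    simp
  exact ⟨w, hE.of_iso (S := .mk f g h.1) (ShortComplex.isoMk a b c h₁ h₂) h.2⟩

/-- A kernel of a deflation is an inflation. -/
lemma conflation_of_kernel (hg : IsDeflation E g) [Mono f] (w : f ≫ g = 0)
    (hl : ∀ ⦃T : C⦄ (t : T ⟶ Y), t ≫ g = 0 → ∃ s, s ≫ f = t) : IsConflation E f g := by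
  obtain ⟨K, k, h⟩ := hg.exists_conflation
  have := hE.mono h
  obtain ⟨s, hs⟩ := hl k h.zero
  obtain ⟨t, ht⟩ := hE.lift h f w
  refine hE.conflation_of_iso ⟨s, t, ?_, ?_⟩ (Iso.refl _) (Iso.refl _) ?_ ?_ h
  · rw [← cancel_mono k]; simp [ht, hs]
  · rw [← cancel_mono f]; simp [ht, hs]
  · simp [hs]
  · simp

/-- A cokernel of an inflation is a deflation. -/
lemma conflation_of_cokernel (hf : IsInflation E f) [Epi g] (w : f ≫ g = 0)
    (hl : ∀ ⦃T : C⦄ (t : Y ⟶ T), f ≫ t = 0 → ∃ s, g ≫ s = t) : IsConflation E f g := by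
  obtain ⟨K, k, h⟩ := hf.exists_conflation
  have := hE.epi h
  obtain ⟨s, hs⟩ := hl k h.zero
  obtain ⟨t, ht⟩ := hE.desc h g w
  refine hE.conflation_of_iso (Iso.refl _) (Iso.refl _) ⟨t, s, ?_, ?_⟩ ?_ ?_ h
  · rw [← cancel_epi k]; simp [reassoc_of% ht, hs]
  · rw [← cancel_epi g]; simp [reassoc_of% hs, ht]
  · simp
  · simp [ht]

end

lemma inflation_of_iso {X Y X' Y' : C} {f : X ⟶ Y} {f' : X' ⟶ Y'} (a : X ≅ X') (b : Y ≅ Y')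
    (h₁ : a.hom ≫ f' = f ≫ b.hom) (h : IsInflation E f) : IsInflation E f' := by
  obtain ⟨Z, g, h⟩ := h.exists_conflation
  exact (hE.conflation_of_iso (g' := b.inv ≫ g) a b (Iso.refl _) h₁ (by simp) h).inflation

lemma deflation_of_iso {Y Z Y' Z' : C} {g : Y ⟶ Z} {g' : Y' ⟶ Z'} (b : Y ≅ Y') (c : Z ≅ Z')
    (h₂ : b.hom ≫ g' = g ≫ c.hom) (h : IsDeflation E g) : IsDeflation E g' := by
  obtain ⟨X, f, h⟩ := h.exists_conflation
  exact (hE.conflation_of_iso (f' := f ≫ b.hom) (Iso.refl _) b c (by simp) h₂ h).deflation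

lemma inflation_of_isIso {X Y : C} (f : X ⟶ Y) [IsIso f] : IsInflation E f :=
  hE.inflation_of_iso (Iso.refl _) (asIso f) (by simp) (hE.inflation_id X)

lemma deflation_of_isIso {X Y : C} (f : X ⟶ Y) [IsIso f] : IsDeflation E f :=
  hE.deflation_of_iso (Iso.refl _) (asIso f) (by simp) (hE.deflation_id X)

lemma conflation_isIso_zero {X Y Z : C} (f : X ⟶ Y) [IsIso f] (hZ : IsZero Z) (g : Y ⟶ Z) :
    IsConflation E f g :=
  have : Epi g := ⟨fun _ _ _ => hZ.eq_of_src _ _⟩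
  hE.conflation_of_cokernel (hE.inflation_of_isIso f) (hZ.eq_of_tgt _ _)
    fun T t ht => ⟨0, by rw [← cancel_epi f, ht]; simp⟩

lemma conflation_zero_isIso {X Y Z : C} (f : X ⟶ Y) (hX : IsZero X) (g : Y ⟶ Z) [IsIso g] :
    IsConflation E f g :=
  have : Mono f := ⟨fun _ _ _ => hX.eq_of_tgt _ _⟩
  hE.conflation_of_kernel (hE.deflation_of_isIso g) (hX.eq_of_src _ _)
    fun T t ht => ⟨0, by rw [← cancel_mono g, ht]; simp⟩

lemma conflation_of_isZero {X Y Z : C} (f : X ⟶ Y) (g : Y ⟶ Z) (hX : IsZero X) (hY : IsZero Y)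
    (hZ : IsZero Z) : IsConflation E f g :=
  have : IsIso f := ⟨0, hX.eq_of_src _ _, hY.eq_of_src _ _⟩
  hE.conflation_isIso_zero f hZ g

/-! ### Pullbacks and pushouts of conflations -/

lemma deflation_of_isPullback {Y Z Y' Z' : C} {g : Y ⟶ Z} {c : Z' ⟶ Z} {b : Y' ⟶ Y}
    {g' : Y' ⟶ Z'} (sq : IsPullback b g' g c) (hg : IsDeflation E g) : IsDeflation E g' := by
  obtain ⟨Y'', b', g'', sq', h⟩ := hE.deflation_pullback g c hg
  exact hE.deflation_of_iso (sq'.isoIsPullback _ _ sq) (Iso.refl _) (by simp) h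

lemma inflation_of_isPushout {X Y X' Y' : C} {f : X ⟶ Y} {a : X ⟶ X'} {b : Y ⟶ Y'}
    {f' : X' ⟶ Y'} (sq : IsPushout f a b f') (hf : IsInflation E f) : IsInflation E f' := by
  obtain ⟨Y'', b', g'', sq', h⟩ := hE.inflation_pushout f a hf
  exact hE.inflation_of_iso (Iso.refl _) (sq'.isoIsPushout _ _ sq) (by simp) h

lemma exists_pullback_conflation {X Y Z Y' Z' : C} {f : X ⟶ Y} {g : Y ⟶ Z} {c : Z' ⟶ Z}
    {b : Y' ⟶ Y} {g' : Y' ⟶ Z'} (sq : IsPullback b g' g c) (h : IsConflation E f g) :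
    ∃ f' : X ⟶ Y', f' ≫ b = f ∧ IsConflation E f' g' := by
  have := hE.mono h
  obtain ⟨f', h₁, h₂⟩ := sq.exists_lift f 0 (by simp [h.zero])
  have : Mono f' := by
    have : Mono (f' ≫ b) := by rwa [h₁]
    exact mono_of_mono f' b
  refine ⟨f', h₁, hE.conflation_of_kernel (hE.deflation_of_isPullback sq h.deflation) h₂ ?_⟩
  intro T t ht
  obtain ⟨s, hs⟩ := hE.lift h (t ≫ b) (by rw [Category.assoc, sq.w, reassoc_of% ht, zero_comp])
  exact ⟨s, sq.hom_ext (by simp [h₁, hs]) (by simp [h₂, ht])⟩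

lemma exists_pushout_conflation {X Y Z X' Y' : C} {f : X ⟶ Y} {g : Y ⟶ Z} {a : X ⟶ X'}
    {b : Y ⟶ Y'} {f' : X' ⟶ Y'} (sq : IsPushout f a b f') (h : IsConflation E f g) :
    ∃ g' : Y' ⟶ Z, b ≫ g' = g ∧ IsConflation E f' g' := by
  have := hE.epi h
  obtain ⟨g', h₁, h₂⟩ := sq.exists_desc g 0 (by simp [h.zero])
  have : Epi g' := by
    have : Epi (b ≫ g') := by rwa [h₁]
    exact epi_of_epi b g'
  refine ⟨g', h₁, hE.conflation_of_cokernel (hE.inflation_of_isPushout sq h.inflation) h₂ ?_⟩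
  intro T t ht
  obtain ⟨s, hs⟩ := hE.desc h (b ≫ t) (by rw [reassoc_of% sq.w, ht, comp_zero])
  exact ⟨s, sq.hom_ext (by simp [reassoc_of% h₁, hs]) (by simp [reassoc_of% h₂, ht])⟩

lemma exists_pullback {X Y Z Z' : C} {f : X ⟶ Y} {g : Y ⟶ Z} (h : IsConflation E f g)
    (c : Z' ⟶ Z) : ∃ (Y' : C) (b : Y' ⟶ Y) (g' : Y' ⟶ Z') (f' : X ⟶ Y'),
      IsPullback b g' g c ∧ f' ≫ b = f ∧ IsConflation E f' g' := by
  obtain ⟨Y', b, g', sq, -⟩ := hE.deflation_pullback g c h.deflation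
  obtain ⟨f', h'⟩ := hE.exists_pullback_conflation sq h
  exact ⟨Y', b, g', f', sq, h'⟩

lemma exists_pushout {X Y Z X' : C} {f : X ⟶ Y} {g : Y ⟶ Z} (h : IsConflation E f g)
    (a : X ⟶ X') : ∃ (Y' : C) (b : Y ⟶ Y') (f' : X' ⟶ Y') (g' : Y' ⟶ Z),
      IsPushout f a b f' ∧ b ≫ g' = g ∧ IsConflation E f' g' := by
  obtain ⟨Y', b, f', sq, -⟩ := hE.inflation_pushout f a h.inflation
  obtain ⟨g', h'⟩ := hE.exists_pushout_conflation sq h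
  exact ⟨Y', b, f', g', sq, h'⟩

/-- The kernel of a composition of deflations is an extension of their kernels. -/
lemma exists_kernel_comp {X Y Z Z₁ Z₂ : C} {f : X ⟶ Y} {g : Y ⟶ Z} {i : Z₁ ⟶ Z} {p : Z ⟶ Z₂}
    (h : IsConflation E f g) (h' : IsConflation E i p) :
    ∃ (Y₁ : C) (j : Y₁ ⟶ Y) (d : Y₁ ⟶ Z₁) (x : X ⟶ Y₁), IsPullback j d g i ∧ x ≫ j = f ∧
      IsConflation E x d ∧ IsConflation E j (g ≫ p) := by
  obtain ⟨Y₁, j, d, x, sq, h₁, h₂⟩ := hE.exists_pullback h i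
  have := hE.mono h'
  have : Mono j := ⟨fun s t hst => sq.hom_ext hst (by
    rw [← cancel_mono i, Category.assoc, Category.assoc, ← sq.w, reassoc_of% hst])⟩
  refine ⟨Y₁, j, d, x, sq, h₁, h₂, hE.conflation_of_kernel
    (hE.deflation_comp _ _ h.deflation h'.deflation)
    (by rw [← Category.assoc, sq.w, Category.assoc, h'.zero, comp_zero]) fun T t ht => ?_⟩
  obtain ⟨s, hs⟩ := hE.lift h' (t ≫ g) (by simpa using ht)
  obtain ⟨l, hl, -⟩ := sq.exists_lift t s hs.symm
  exact ⟨l, hl⟩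

/-- The cokernel of a composition of inflations is an extension of their cokernels. -/
lemma exists_cokernel_comp {X Y Z Q R : C} {f : X ⟶ Y} {p : Y ⟶ Q} {g : Y ⟶ Z} {r : Z ⟶ R}
    (h : IsConflation E f p) (h' : IsConflation E g r) :
    ∃ (Q' : C) (q : Z ⟶ Q') (m : Q ⟶ Q') (n : Q' ⟶ R), IsPushout g p q m ∧ q ≫ n = r ∧
      IsConflation E m n ∧ IsConflation E (f ≫ g) q := by
  obtain ⟨Q', q, m, n, sq, h₁, h₂⟩ := hE.exists_pushout h' p
  have := hE.epi h
  have : Epi q := ⟨fun s t hst => sq.hom_ext hst (by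
    rw [← cancel_epi p, ← reassoc_of% sq.w, ← reassoc_of% sq.w, hst])⟩
  refine ⟨Q', q, m, n, sq, h₁, h₂, hE.conflation_of_cokernel
    (hE.inflation_comp _ _ h.inflation h'.inflation)
    (by rw [Category.assoc, sq.w, reassoc_of% h.zero, zero_comp]) fun T t ht => ?_⟩
  obtain ⟨s, hs⟩ := hE.desc h (g ≫ t) (by simpa using ht)
  obtain ⟨l, hl, -⟩ := sq.exists_desc t s hs.symm
  exact ⟨l, hl⟩

/-- If `p` is a cokernel of `i`, then `j` is a kernel of the composite deflation `g ≫ p`. -/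
lemma inflation_of_isPullback {Y Z Y₁ Z₁ : C} {g : Y ⟶ Z} {i : Z₁ ⟶ Z} {j : Y₁ ⟶ Y}
    {d : Y₁ ⟶ Z₁} (sq : IsPullback j d g i) (hg : IsDeflation E g) (hi : IsInflation E i) :
    IsInflation E j := by
  obtain ⟨X, f, h⟩ := hg.exists_conflation
  obtain ⟨Z₂, p, h'⟩ := hi.exists_conflation
  obtain ⟨Y₁', j', d', x, sq', -, -, h₂⟩ := hE.exists_kernel_comp h h'
  exact hE.inflation_of_iso (sq'.isoIsPullback _ _ sq) (Iso.refl _) (by simp) h₂.inflation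

/-! ### Five lemmas -/

/-- The short five lemma for conflations with the same ends. -/
lemma isIso_of_conflations {X Y Y' Z : C} {f : X ⟶ Y} {g : Y ⟶ Z} {f' : X ⟶ Y'} {g' : Y' ⟶ Z}
    (h : IsConflation E f g) (h' : IsConflation E f' g') (b : Y ⟶ Y') (h₁ : f ≫ b = f')
    (h₂ : b ≫ g' = g) : IsIso b := by
  have := hE.mono h
  have := hE.mono h'
  have : Mono b := by
    rw [Preadditive.mono_iff_cancel_zero]
    intro T t ht
    obtain ⟨s, rfl⟩ := hE.lift h t (by rw [← h₂, reassoc_of% ht, zero_comp])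
    rw [Category.assoc, h₁] at ht
    rw [zero_of_comp_mono f' ht, zero_comp]
  -- The inverse in terms of elements: given `y'`, pick `y` over the same point of `Z` and correct
  -- it by `y' - b y`, which comes from `X`. The pullback `P` parametrizes the pairs `(y', y)`, the
  -- map `u` is the correction, and `i' ≫ u = -𝟙 X` says that the result does not depend on `y`.
  obtain ⟨P, q, p, i, sq, h₃, h₄⟩ := hE.exists_pullback h' g
  have sq' := sq.flip
  obtain ⟨i', h₅, h₆⟩ := hE.exists_pullback_conflation sq' h
  have := hE.epi h₆
  obtain ⟨u, hu⟩ := hE.lift h' (q - p ≫ b) (by simp [h₂, sq.w])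
  have hu' : i' ≫ u = -𝟙 X := by
    rw [← cancel_mono f', Category.assoc, hu]
    simp [reassoc_of% h₅, h₆.zero, h₁]
  obtain ⟨r, hr⟩ := hE.desc h₆ (p + u ≫ f) (by simp [h₅, reassoc_of% hu'])
  have hrb : r ≫ b = 𝟙 Y' := by
    rw [← cancel_epi q, reassoc_of% hr]
    simp [h₁, hu]
  exact ⟨r, by rw [← cancel_mono b, Category.assoc, hrb]; simp, hrb⟩

/-- If the outer maps of a morphism of conflations are inflations, then so is the middle map. -/
lemma inflation_of_outer {X Y Z X' Y' Z' : C} {f : X ⟶ Y} {g : Y ⟶ Z} {f' : X' ⟶ Y'}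
    {g' : Y' ⟶ Z'} {a : X ⟶ X'} {b : Y ⟶ Y'} {c : Z ⟶ Z'} (h : IsConflation E f g)
    (h' : IsConflation E f' g') (h₁ : f ≫ b = a ≫ f') (h₂ : b ≫ g' = g ≫ c)
    (ha : IsInflation E a) (hc : IsInflation E c) : IsInflation E b := by
  obtain ⟨P, b₁, f₁, g₁, sq, h₃, h₄⟩ := hE.exists_pushout h a
  obtain ⟨Q, b₂, g₂, f₂, sq', h₅, h₆⟩ := hE.exists_pullback h' c
  obtain ⟨t, ht, ht'⟩ := sq.exists_desc b f' h₁
  have htg : t ≫ g' = g₁ ≫ c := sq.hom_ext (by rw [reassoc_of% ht, reassoc_of% h₃, h₂])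
    (by rw [reassoc_of% ht', reassoc_of% h₄.zero, h'.zero, zero_comp])
  obtain ⟨s, hs, hs'⟩ := sq'.exists_lift t g₁ htg
  have : IsIso s := hE.isIso_of_conflations h₄ h₆ s
    (sq'.hom_ext (by simp [hs, ht', h₅]) (by simp [hs', h₄.zero, h₆.zero])) hs'
  -- Here `b₁` is a pushout of `a`, `b₂` is a pullback of `c` along the deflation `g'`, and `s` is
  -- an isomorphism by the short five lemma.
  have hb : b = b₁ ≫ s ≫ b₂ := by rw [hs, ht]
  rw [hb]
  exact hE.inflation_comp _ _ (hE.inflation_of_isPushout sq.flip ha)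
    (hE.inflation_comp _ _ (hE.inflation_of_isIso s)
      (hE.inflation_of_isPullback sq' h'.deflation hc))

/-! ### Split conflations -/

/-- The projection to `Y` is the pullback of the deflation `X ⟶ 0` along `Y ⟶ 0`. -/
lemma conflation_biprod {X Y : C} {b : BinaryBicone X Y} (hb : b.IsBilimit) :
    IsConflation E b.inl b.snd := by
  obtain ⟨Z, hZ⟩ := hE.hasZeroObject
  have sq : IsPullback b.snd b.fst (0 : Y ⟶ Z) 0 :=
    .of_isLimit' ⟨hZ.eq_of_tgt _ _⟩ (PullbackCone.IsLimit.mk _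
      (fun s => s.fst ≫ b.inr + s.snd ≫ b.inl) (by simp) (by simp) fun s m h₁ h₂ => by
        have := IsBilimit.binary_total hb
        rw [← Category.comp_id m, ← this]
        simp [reassoc_of% h₁, reassoc_of% h₂, add_comm])
  have : Mono b.inl := ⟨fun s t h => by simpa using h =≫ b.fst⟩
  have hd : IsDeflation E (0 : X ⟶ Z) :=
    (hE.conflation_isIso_zero (𝟙 X) hZ 0).deflation
  refine hE.conflation_of_kernel (hE.deflation_of_isPullback sq.flip hd) (by simp) ?_
  intro T t ht
  exact ⟨t ≫ b.fst, by
    conv_rhs => rw [← Category.comp_id t, ← IsBilimit.binary_total hb]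
    simp [reassoc_of% ht]⟩

end IsExactCategory

end Exact

end FrobQuot
namespace FrobQuot

universe v u w w'

/-! ### Exact structures on extension-closed subcategories and on functor categories -/

section

variable {C : Type u} [Category.{v} C] [Preadditive C] {E : ObjectProperty (ShortComplex C)}

/-- The conflations of `C` with terms in a full subcategory. -/
def subConflation (E : ObjectProperty (ShortComplex C)) (Q : ObjectProperty C) :
    ObjectProperty (ShortComplex Q.FullSubcategory) := fun S => E (S.map Q.ι)

lemma isConflation_sub_iff {Q : ObjectProperty C} {X Y Z : Q.FullSubcategory} {f : X ⟶ Y}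
    {g : Y ⟶ Z} : IsConflation (subConflation E Q) f g ↔ IsConflation E f.hom g.hom :=
  ⟨fun h => ⟨congrArg (·.hom) h.1, h.2⟩, fun h => ⟨Q.hom_ext h.1, h.2⟩⟩

/-- An extension-closed full subcategory of an exact category is exact. -/
lemma IsExactCategory.sub (hE : IsExactCategory E) {Q : ObjectProperty C}
    (hzero : ∃ Z, IsZero Z ∧ Q Z)
    (hext : ∀ ⦃X Y Z : C⦄ (f : X ⟶ Y) (g : Y ⟶ Z), IsConflation E f g → Q X → Q Z → Q Y) :
    IsExactCategory (subConflation E Q) := by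
  obtain ⟨Z, hZ, hQZ⟩ := hzero
  have hZ' : IsZero (⟨Z, hQZ⟩ : Q.FullSubcategory) := by
    rw [IsZero.iff_id_eq_zero]
    exact Q.hom_ext (hZ.eq_of_src _ _)
  refine
    { hasZeroObject := ⟨⟨_, hZ'⟩⟩
      hasBinaryBiproducts := ⟨fun X Y => ?_⟩
      kernelCokernel := fun S hS => .of_map Q.ι (hE.kernelCokernel _ hS)
      of_iso := fun {S T} e hS => hE.of_iso (Q.ι.mapShortComplex.mapIso e) hS
      inflation_id := fun X => ?_
      deflation_id := fun X => ?_
      inflation_comp := ?_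
      deflation_comp := ?_
      inflation_pushout := ?_
      deflation_pullback := ?_ }
  · have := hE.hasBinaryBiproducts
    have hQ : Q (X.obj ⊞ Y.obj) :=
      hext _ _ (hE.conflation_biprod (BinaryBiproduct.isBilimit X.obj Y.obj)) X.property Y.property
    let b : BinaryBicone X Y :=
      { pt := ⟨_, hQ⟩
        fst := ObjectProperty.homMk biprod.fst
        snd := ObjectProperty.homMk biprod.snd
        inl := ObjectProperty.homMk biprod.inl
        inr := ObjectProperty.homMk biprod.inr
        inl_fst := Q.hom_ext (by simp)
        inl_snd := Q.hom_ext (by simp)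
        inr_fst := Q.hom_ext (by simp)
        inr_snd := Q.hom_ext (by simp) }
    exact ⟨⟨b, isBinaryBilimitOfTotal b (Q.hom_ext biprod.total)⟩⟩
  · exact IsConflation.inflation (isConflation_sub_iff.2
      (hE.conflation_isIso_zero (𝟙 X.obj) hZ (0 : X ⟶ ⟨Z, hQZ⟩).hom))
  · exact IsConflation.deflation (isConflation_sub_iff.2
      (hE.conflation_zero_isIso (0 : ⟨Z, hQZ⟩ ⟶ X).hom hZ (𝟙 X.obj)))
  · rintro X Y Z f g ⟨R, p, h⟩ ⟨T, r, h'⟩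
    -- The cokernel of the composite is an extension of the two cokernels, hence stays in `Q`. The
    -- remaining axioms use extension-closedness in the same way, for kernels, pushouts and
    -- pullbacks.
    obtain ⟨Q', q, m, n, -, -, h₁, h₂⟩ := hE.exists_cokernel_comp
      (isConflation_sub_iff.1 h) (isConflation_sub_iff.1 h')
    have hQ' : Q Q' := hext m n h₁ R.property T.property
    exact IsConflation.inflation
      (g := (ObjectProperty.homMk q : Z ⟶ (⟨Q', hQ'⟩ : Q.FullSubcategory)))
      (isConflation_sub_iff.2 h₂)
  · rintro X Y Z f g ⟨R, p, h⟩ ⟨T, r, h'⟩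
    obtain ⟨Q', q, m, n, -, -, h₁, h₂⟩ := hE.exists_kernel_comp
      (isConflation_sub_iff.1 h) (isConflation_sub_iff.1 h')
    have hQ' : Q Q' := hext n m h₁ R.property T.property
    exact IsConflation.deflation
      (f := (ObjectProperty.homMk q : (⟨Q', hQ'⟩ : Q.FullSubcategory) ⟶ X))
      (isConflation_sub_iff.2 h₂)
  · rintro X Y X' f a ⟨Z, g, h⟩
    obtain ⟨Y', b, f', g', sq, -, h'⟩ := hE.exists_pushout (isConflation_sub_iff.1 h) a.hom
    have hY' : Q Y' := hext _ _ h' X'.property Z.property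
    refine ⟨⟨Y', hY'⟩, ObjectProperty.homMk b, ObjectProperty.homMk f', ?_,
      IsConflation.inflation (g := (ObjectProperty.homMk g' : (⟨Y', hY'⟩ : Q.FullSubcategory) ⟶ Z))
        (isConflation_sub_iff.2 h')⟩
    exact IsPushout.of_map Q.ι (Q.hom_ext sq.w) sq
  · rintro Y Z Z' g c ⟨X, f, h⟩
    obtain ⟨Y', b, g', f', sq, -, h'⟩ := hE.exists_pullback (isConflation_sub_iff.1 h) c.hom
    have hY' : Q Y' := hext _ _ h' X.property Z'.property
    refine ⟨⟨Y', hY'⟩, ObjectProperty.homMk b, ObjectProperty.homMk g', ?_,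
      IsConflation.deflation (f := (ObjectProperty.homMk f' : X ⟶ (⟨Y', hY'⟩ : Q.FullSubcategory)))
        (isConflation_sub_iff.2 h')⟩
    exact IsPullback.of_map Q.ι (Q.hom_ext sq.w) sq

variable {J : Type w} [Category.{w'} J]

/-- The sequences of functors that are conflations in each component. -/
def functorConflation (E : ObjectProperty (ShortComplex C)) (J : Type w) [Category.{w'} J] :
    ObjectProperty (ShortComplex (J ⥤ C)) := fun S =>
  ∀ j : J, E (S.map ((evaluation J C).obj j))

lemma isConflation_functor_iff {X Y Z : J ⥤ C} {f : X ⟶ Y} {g : Y ⟶ Z} :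
    IsConflation (functorConflation E J) f g ↔ ∀ j, IsConflation E (f.app j) (g.app j) :=
  ⟨fun h j => ⟨NatTrans.congr_app h.1 j, h.2 j⟩,
    fun h => ⟨NatTrans.ext (funext fun j => (h j).1), fun j => (h j).2⟩⟩

namespace IsExactCategory

variable (hE : IsExactCategory E)
include hE

/-- Cokernels are chosen independently at each `j`; their universal properties supply the transition
maps, and functoriality holds because the `g j` are epimorphisms. -/
lemma exists_functor_cokernel {X Y : J ⥤ C} (f : X ⟶ Y) (h : ∀ j, IsInflation E (f.app j)) :
    ∃ (Z : J ⥤ C) (g : Y ⟶ Z), IsConflation (functorConflation E J) f g := by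
  choose Z g h using fun j => (h j).exists_conflation
  have := fun j => hE.epi (h j)
  choose m hm using fun (i j : J) (u : i ⟶ j) => hE.desc (h i) (Y.map u ≫ g j)
    (by rw [← Category.assoc, ← f.naturality, Category.assoc, (h j).zero, comp_zero])
  refine ⟨{ obj := Z, map := fun {i j} u => m i j u, map_id := fun i => ?_,
            map_comp := fun {i j k} u v => ?_ },
    { app := g, naturality := fun i j u => (hm i j u).symm }, isConflation_functor_iff.2 h⟩
  · rw [← cancel_epi (g i), hm]; simp
  · rw [← cancel_epi (g i), hm, reassoc_of% hm, hm]; simp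

lemma exists_functor_kernel {Y Z : J ⥤ C} (g : Y ⟶ Z) (h : ∀ j, IsDeflation E (g.app j)) :
    ∃ (X : J ⥤ C) (f : X ⟶ Y), IsConflation (functorConflation E J) f g := by
  choose X f h using fun j => (h j).exists_conflation
  have := fun j => hE.mono (h j)
  choose m hm using fun (i j : J) (u : i ⟶ j) => hE.lift (h j) (f i ≫ Y.map u)
    (by rw [Category.assoc, g.naturality, ← Category.assoc, (h i).zero, zero_comp])
  refine ⟨{ obj := X, map := fun {i j} u => m i j u, map_id := fun i => ?_,
            map_comp := fun {i j k} u v => ?_ },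
    { app := f, naturality := fun i j u => hm i j u }, isConflation_functor_iff.2 h⟩
  · rw [← cancel_mono (f i), hm]; simp
  · rw [← cancel_mono (f k), hm, Category.assoc, hm, ← Category.assoc, hm]; simp

lemma isInflation_functor_iff {X Y : J ⥤ C} {f : X ⟶ Y} :
    IsInflation (functorConflation E J) f ↔ ∀ j, IsInflation E (f.app j) :=
  ⟨fun ⟨_, _, h⟩ j => (isConflation_functor_iff.1 h j).inflation,
    fun h => hE.exists_functor_cokernel f h⟩

lemma isDeflation_functor_iff {X Y : J ⥤ C} {f : X ⟶ Y} :
    IsDeflation (functorConflation E J) f ↔ ∀ j, IsDeflation E (f.app j) :=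
  ⟨fun ⟨_, _, h⟩ j => (isConflation_functor_iff.1 h j).deflation,
    fun h => hE.exists_functor_kernel f h⟩

/-- A functor category with values in an exact category is exact. -/
lemma functorCategory (J : Type w) [Category.{w'} J] :
    IsExactCategory (functorConflation E J) where
  hasZeroObject := by
    obtain ⟨Z, hZ⟩ := hE.hasZeroObject
    exact ⟨⟨(Functor.const J).obj Z, Functor.isZero _ fun _ => hZ⟩⟩
  hasBinaryBiproducts := by
    have := hE.hasBinaryBiproducts
    exact HasBinaryBiproducts.of_hasBinaryProducts
  kernelCokernel S hS := by
    have hS' := isConflation_functor_iff.1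
      (show IsConflation (functorConflation E J) S.f S.g from ⟨S.zero, hS⟩)
    have := fun j => hE.mono (hS' j)
    have := fun j => hE.epi (hS' j)
    refine .of_lift_desc (NatTrans.mono_of_mono_app _) (NatTrans.epi_of_epi_app _)
      (fun T t ht => ?_) (fun T t ht => ?_)
    · choose s hs using fun j => hE.lift (hS' j) (t.app j) (NatTrans.congr_app ht j)
      exact ⟨{
        app := s
        naturality := fun i j u => by
          rw [← cancel_mono (S.f.app j), Category.assoc, Category.assoc, hs, S.f.naturality,
            reassoc_of% hs, t.naturality] }, NatTrans.ext (funext hs)⟩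
    · choose s hs using fun j => hE.desc (hS' j) (t.app j) (NatTrans.congr_app ht j)
      exact ⟨{
        app := s
        naturality := fun i j u => by
          rw [← cancel_epi (S.g.app i), ← S.g.naturality_assoc, hs, reassoc_of% hs,
            t.naturality] }, NatTrans.ext (funext hs)⟩
  of_iso e hS j := hE.of_iso (((evaluation J C).obj j).mapShortComplex.mapIso e) (hS j)
  inflation_id X := hE.isInflation_functor_iff.2 fun j => hE.inflation_id _
  deflation_id X := hE.isDeflation_functor_iff.2 fun j => hE.deflation_id _
  inflation_comp f g hf hg := hE.isInflation_functor_iff.2 fun j => hE.inflation_comp _ _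
    (hE.isInflation_functor_iff.1 hf j) (hE.isInflation_functor_iff.1 hg j)
  deflation_comp f g hf hg := hE.isDeflation_functor_iff.2 fun j => hE.deflation_comp _ _
    (hE.isDeflation_functor_iff.1 hf j) (hE.isDeflation_functor_iff.1 hg j)
  inflation_pushout {X Y X'} f a hf := by
    choose Y' b f' sq h' using fun j => hE.inflation_pushout (f.app j) (a.app j)
      (hE.isInflation_functor_iff.1 hf j)
    choose m hm hm' using fun (i j : J) (u : i ⟶ j) => (sq i).exists_desc (Y.map u ≫ b j)
      (X'.map u ≫ f' j) (by
        rw [← f.naturality_assoc, (sq j).w, a.naturality_assoc])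
    let Y'' : J ⥤ C :=
      { obj := Y', map := fun {i j} u => m i j u,
        map_id := fun i => (sq i).hom_ext (by simp [hm]) (by simp [hm'])
        map_comp := fun {i j k} u v => (sq i).hom_ext
          (by simp [hm, reassoc_of% hm]) (by simp [hm', reassoc_of% hm']) }
    exact ⟨Y'', { app := b, naturality := fun i j u => (hm i j u).symm },
      { app := f', naturality := fun i j u => (hm' i j u).symm },
      .of_forall_isPushout_app sq, hE.isInflation_functor_iff.2 h'⟩
  deflation_pullback {Y Z Z'} g c hg := by
    choose Y' b g' sq h' using fun j => hE.deflation_pullback (g.app j) (c.app j)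
      (hE.isDeflation_functor_iff.1 hg j)
    choose m hm hm' using fun (i j : J) (u : i ⟶ j) => (sq j).exists_lift (b i ≫ Y.map u)
      (g' i ≫ Z'.map u) (by
        rw [Category.assoc, g.naturality, ← Category.assoc, (sq i).w, Category.assoc,
          Category.assoc, c.naturality])
    let Y'' : J ⥤ C :=
      { obj := Y', map := fun {i j} u => m i j u,
        map_id := fun i => (sq i).hom_ext (by simp [hm]) (by simp [hm'])
        map_comp := fun {i j k} u v => (sq k).hom_ext
          (by simp [hm, reassoc_of% hm]) (by simp [hm', reassoc_of% hm']) }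
    exact ⟨Y'', { app := b, naturality := fun i j u => hm i j u },
      { app := g', naturality := fun i j u => hm' i j u },
      .of_forall_isPullback_app sq, hE.isDeflation_functor_iff.2 h'⟩

end IsExactCategory

end

/-! ### The exact category of `n`-inflations -/

section

variable {C : Type u} [Category.{v} C] [Preadditive C] {E : ObjectProperty (ShortComplex C)}
  {n : ℕ}

lemma Inf.isConflation_iff {X Y Z : Inf E n} {f : X ⟶ Y} {g : Y ⟶ Z} :
    IsConflation (Inf.conflation E n) f g ↔
      ∀ i, IsConflation E (f.hom.app i) (g.hom.app i) :=
  (isConflation_sub_iff (E := functorConflation E (Fin n))).trans isConflation_functor_iff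

lemma Inf.isDeflation_app {Y Z : Inf E n} {g : Y ⟶ Z} (h : IsDeflation (Inf.conflation E n) g)
    (i : Fin n) : IsDeflation E (g.hom.app i) := by
  obtain ⟨X, f, h⟩ := h.exists_conflation
  exact (Inf.isConflation_iff.1 h i).deflation

namespace IsExactCategory

variable (hE : IsExactCategory E)
include hE

/-- A transition map of `Y` is the middle of a morphism of conflations whose outer maps are
transition maps of `X` and `Z`. -/
lemma isNInflation_extension ⦃X Y Z : Fin n ⥤ C⦄ (f : X ⟶ Y) (g : Y ⟶ Z)
    (h : IsConflation (functorConflation E (Fin n)) f g) (hX : isNInflation E n X)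
    (hZ : isNInflation E n Z) : isNInflation E n Y := fun i hi =>
  hE.inflation_of_outer (isConflation_functor_iff.1 h _) (isConflation_functor_iff.1 h _)
    (f.naturality _).symm (g.naturality _) (hX i hi) (hZ i hi)

/-- The category of `n`-inflations is exact. -/
lemma inf (n : ℕ) : IsExactCategory (Inf.conflation E n) := by
  refine (hE.functorCategory (Fin n)).sub (Q := isNInflation E n) ?_ hE.isNInflation_extension
  obtain ⟨Z, hZ⟩ := hE.hasZeroObject
  exact ⟨(Functor.const _).obj Z, Functor.isZero _ fun _ => hZ,
    fun i hi => hE.inflation_id _⟩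

lemma isInflation_map (X : Inf E n) {i j : Fin n} (u : i ⟶ j) :
    IsInflation E (X.obj.map u) := by
  obtain ⟨i, hi⟩ := i
  obtain ⟨j, hj⟩ := j
  have hij : i ≤ j := leOfHom u
  induction j, hij using Nat.le_induction with
  | base =>
    rw [Subsingleton.elim u (𝟙 _), X.obj.map_id]
    exact hE.inflation_id _
  | succ k hk ih =>
    rw [Subsingleton.elim u ((homOfLE hk : (⟨i, hi⟩ : Fin n) ⟶ ⟨k, by omega⟩) ≫
      homOfLE (Nat.le_succ k)), X.obj.map_comp]
    exact hE.inflation_comp _ _ (ih _ _) (X.property k hj)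

end IsExactCategory

end

end FrobQuot
namespace FrobQuot

universe v u v' u'

/-! ### Projective and injective objects -/

section

variable {C : Type u} [Category.{v} C]

lemma isPullback_of_exists {P X Y Z : C} {fst : P ⟶ X} {snd : P ⟶ Y} {f : X ⟶ Z} {g : Y ⟶ Z}
    (w : fst ≫ f = snd ≫ g)
    (hl : ∀ ⦃T : C⦄ (s : T ⟶ X) (t : T ⟶ Y), s ≫ f = t ≫ g → ∃ l, l ≫ fst = s ∧ l ≫ snd = t)
    (hu : ∀ ⦃T : C⦄ (l l' : T ⟶ P), l ≫ fst = l' ≫ fst → l ≫ snd = l' ≫ snd → l = l') :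
    IsPullback fst snd f g :=
  .of_isLimit' ⟨w⟩ (PullbackCone.IsLimit.mk _
    (fun s => (hl s.fst s.snd s.condition).choose)
    (fun s => (hl s.fst s.snd s.condition).choose_spec.1)
    (fun s => (hl s.fst s.snd s.condition).choose_spec.2)
    (fun s _ h₁ h₂ => hu _ _ (h₁.trans (hl s.fst s.snd s.condition).choose_spec.1.symm)
      (h₂.trans (hl s.fst s.snd s.condition).choose_spec.2.symm)))

lemma isPushout_of_exists {P X Y Z : C} {f : Z ⟶ X} {g : Z ⟶ Y} {inl : X ⟶ P} {inr : Y ⟶ P}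
    (w : f ≫ inl = g ≫ inr)
    (hl : ∀ ⦃T : C⦄ (s : X ⟶ T) (t : Y ⟶ T), f ≫ s = g ≫ t → ∃ l, inl ≫ l = s ∧ inr ≫ l = t)
    (hu : ∀ ⦃T : C⦄ (l l' : P ⟶ T), inl ≫ l = inl ≫ l' → inr ≫ l = inr ≫ l' → l = l') :
    IsPushout f g inl inr :=
  .of_isColimit' ⟨w⟩ (PushoutCocone.IsColimit.mk _
    (fun s => (hl s.inl s.inr s.condition).choose)
    (fun s => (hl s.inl s.inr s.condition).choose_spec.1)
    (fun s => (hl s.inl s.inr s.condition).choose_spec.2)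
    (fun s _ h₁ h₂ => hu _ _ (h₁.trans (hl s.inl s.inr s.condition).choose_spec.1.symm)
      (h₂.trans (hl s.inl s.inr s.condition).choose_spec.2.symm)))

variable [Preadditive C] {E : ObjectProperty (ShortComplex C)}

lemma proj_of_retract {P X : C} (hP : proj E P) (i : X ⟶ P) (r : P ⟶ X) (h : i ≫ r = 𝟙 X) :
    proj E X := fun Y Z g hg t => by
  obtain ⟨k, hk⟩ := hP g hg (r ≫ t)
  exact ⟨i ≫ k, by rw [Category.assoc, hk, reassoc_of% h]⟩

lemma proj_of_iso {P X : C} (e : P ≅ X) (hP : proj E P) : proj E X :=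
  proj_of_retract hP e.inv e.hom e.inv_hom_id

lemma proj_of_isZero {X : C} (hX : IsZero X) : proj E X := fun _ _ _ _ _ =>
  ⟨0, hX.eq_of_src _ _⟩

namespace IsExactCategory

variable (hE : IsExactCategory E)
include hE

section

variable {X Y Z : C} {f : X ⟶ Y} {g : Y ⟶ Z}

lemma splitting_of_section (h : IsConflation E f g) {s : Z ⟶ Y} (hs : s ≫ g = 𝟙 Z) :
    ∃ r : Y ⟶ X, f ≫ r = 𝟙 X ∧ s ≫ r = 0 ∧ r ≫ f + g ≫ s = 𝟙 Y := by
  have := hE.mono h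
  obtain ⟨r, hr⟩ := hE.lift h (𝟙 Y - g ≫ s) (by simp [hs])
  refine ⟨r, ?_, ?_, by simp [hr]⟩
  · rw [← cancel_mono f, Category.assoc, hr]
    simp [reassoc_of% h.zero]
  · rw [← cancel_mono f, Category.assoc, hr]
    simp [reassoc_of% hs]

lemma exists_section_of_retraction (h : IsConflation E f g) {r : Y ⟶ X} (hr : f ≫ r = 𝟙 X) :
    ∃ s : Z ⟶ Y, s ≫ g = 𝟙 Z := by
  have := hE.epi h
  obtain ⟨s, hs⟩ := hE.desc h (𝟙 Y - r ≫ f) (by simp [reassoc_of% hr])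
  refine ⟨s, ?_⟩
  rw [← cancel_epi g, reassoc_of% hs]
  simp [h.zero]

lemma exists_section_of_inj (h : IsConflation E f g) (hX : inj E X) :
    ∃ s : Z ⟶ Y, s ≫ g = 𝟙 Z := by
  obtain ⟨r, hr⟩ := hX f h.inflation (𝟙 X)
  exact hE.exists_section_of_retraction h hr

lemma proj_extension (h : IsConflation E f g) (hX : proj E X) (hZ : proj E Z) : proj E Y := by
  obtain ⟨s, hs⟩ := hZ g h.deflation (𝟙 Z)
  obtain ⟨r, -, -, hr⟩ := hE.splitting_of_section h hs
  intro T T' d hd t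
  obtain ⟨k, hk⟩ := hX d hd (f ≫ t)
  obtain ⟨l, hl⟩ := hZ d hd (s ≫ t)
  refine ⟨r ≫ k + g ≫ l, ?_⟩
  conv_rhs => rw [← Category.id_comp t, ← hr]
  simp [hk, hl]

/-- Deflations from projective objects to the ends of a conflation give such a deflation to the
middle term. -/
lemma exists_horseshoe_deflation (h : IsConflation E f g) {W₁ W₂ : C} {w₁ : W₁ ⟶ X}
    {w₂ : W₂ ⟶ Z} (h₁ : IsDeflation E w₁) (h₂ : IsDeflation E w₂) (hW₂ : proj E W₂) :
    ∃ (W : C) (i : W₁ ⟶ W) (q : W ⟶ W₂) (w : W ⟶ Y), IsConflation E i q ∧ IsDeflation E w := by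
  have := hE.hasBinaryBiproducts
  have := hE.mono h
  obtain ⟨k, hk⟩ := hW₂ g h.deflation w₂
  -- The deflation is the composite `W₁ ⊞ W₂ ⟶ X ⊞ W₂ ⟶ Y`, whose factors are pullbacks of `w₁` and
  -- of `w₂`.
  have sq₁ : IsPullback biprod.fst (biprod.map w₁ (𝟙 W₂)) w₁ biprod.fst :=
    isPullback_of_exists (by simp)
      (fun T s t hst => ⟨biprod.lift s (t ≫ biprod.snd), by simp,
        biprod.hom_ext _ _ (by simp [hst]) (by simp)⟩)
      (fun T l l' hl hl' => biprod.hom_ext _ _ hl (by simpa using hl' =≫ biprod.snd))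
  have sq₂ : IsPullback biprod.snd (biprod.desc f k) w₂ g := by
    refine isPullback_of_exists (biprod.hom_ext' _ _ (by simp [h.zero]) (by simp [hk]))
      (fun T s t hst => ?_) (fun T l l' hl hl' => biprod.hom_ext _ _ ?_ hl)
    · obtain ⟨a, ha⟩ := hE.lift h (t - s ≫ k) (by simp [hk, hst])
      exact ⟨biprod.lift a s, by simp, by simp [biprod.lift_desc, ha]⟩
    · have h₃ : biprod.desc f k = biprod.fst ≫ f + biprod.snd ≫ k := by
        apply biprod.hom_ext' <;> simp
      rw [h₃, Preadditive.comp_add, Preadditive.comp_add, reassoc_of% hl, add_left_inj,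
        ← Category.assoc, ← Category.assoc, cancel_mono] at hl'
      exact hl'
  exact ⟨W₁ ⊞ W₂, biprod.inl, biprod.snd, biprod.map w₁ (𝟙 W₂) ≫ biprod.desc f k,
    hE.conflation_biprod (BinaryBiproduct.isBilimit W₁ W₂),
    hE.deflation_comp _ _ (hE.deflation_of_isPullback sq₁ h₁)
      (hE.deflation_of_isPullback sq₂ h₂)⟩

/-- Inflations from the ends of a conflation to injective objects give such an inflation from the
middle term. -/
lemma exists_horseshoe_inflation (h : IsConflation E f g) {W₁ W₂ : C} {w₁ : X ⟶ W₁}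
    {w₂ : Z ⟶ W₂} (h₁ : IsInflation E w₁) (h₂ : IsInflation E w₂) (hW₁ : inj E W₁) :
    ∃ (W : C) (i : W₁ ⟶ W) (q : W ⟶ W₂) (w : Y ⟶ W), IsConflation E i q ∧ IsInflation E w := by
  have := hE.hasBinaryBiproducts
  have := hE.epi h
  obtain ⟨k, hk⟩ := hW₁ f h.inflation w₁
  -- Dually, the inflation is `Y ⟶ W₁ ⊞ Z ⟶ W₁ ⊞ W₂`, whose factors are pushouts of `w₁` and of
  -- `w₂`.
  have sq₁ : IsPushout w₂ biprod.inr biprod.inr (biprod.map (𝟙 W₁) w₂) :=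
    isPushout_of_exists (by simp)
      (fun T s t hst => ⟨biprod.desc (biprod.inl ≫ t) s, by simp,
        biprod.hom_ext' _ _ (by simp) (by simp [hst])⟩)
      (fun T l l' hl hl' => biprod.hom_ext' _ _ (by simpa using biprod.inl ≫= hl') hl)
  have sq₂ : IsPushout w₁ f biprod.inl (biprod.lift k g) := by
    refine isPushout_of_exists (biprod.hom_ext _ _ (by simp [hk]) (by simp [h.zero]))
      (fun T s t hst => ?_) (fun T l l' hl hl' => biprod.hom_ext' _ _ hl ?_)
    · obtain ⟨a, ha⟩ := hE.desc h (t - k ≫ s) (by simp [reassoc_of% hk, hst])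
      exact ⟨biprod.desc s a, by simp, by simp [biprod.lift_desc, ha]⟩
    · have h₃ : biprod.lift k g = k ≫ biprod.inl + g ≫ biprod.inr := by
        apply biprod.hom_ext <;> simp
      rw [h₃, Preadditive.add_comp, Preadditive.add_comp, Category.assoc, Category.assoc,
        Category.assoc, Category.assoc, hl, add_right_inj, cancel_epi] at hl'
      exact hl'
  exact ⟨W₁ ⊞ W₂, biprod.inl, biprod.snd, biprod.lift k g ≫ biprod.map (𝟙 W₁) w₂,
    hE.conflation_biprod (BinaryBiproduct.isBilimit W₁ W₂),
    hE.inflation_comp _ _ (hE.inflation_of_isPushout sq₂ h₁)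
      (hE.inflation_of_isPushout sq₁ h₂)⟩

/-- A morphism of conflations that is an isomorphism on the left and an inflation in the middle
is an inflation on the right. -/
lemma inflation_of_isIso_left {X' Y' Z' : C} {f' : X' ⟶ Y'} {g' : Y' ⟶ Z'} {a : X ⟶ X'}
    {b : Y ⟶ Y'} {c : Z ⟶ Z'} (h : IsConflation E f g) (h' : IsConflation E f' g')
    (h₁ : f ≫ b = a ≫ f') (h₂ : b ≫ g' = g ≫ c) [IsIso a] (hb : IsInflation E b) :
    IsInflation E c := by
  obtain ⟨R, r, hb⟩ := hb.exists_conflation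
  obtain ⟨Q, q, m, n, sq, -, hm, hq⟩ := hE.exists_cokernel_comp h hb
  have := hE.epi h
  have := hE.epi h'
  have := hE.epi hq
  -- As `a` is invertible, `q` and `g'` are cokernels of the same subobject of `Y'`. This identifies
  -- `c` with the inflation `m` of Noether's isomorphism.
  obtain ⟨u, hu⟩ := hE.desc hq g' (by rw [h₁, Category.assoc, h'.zero, comp_zero])
  obtain ⟨v, hv⟩ := hE.desc h' q (by
    rw [← cancel_epi a, ← reassoc_of% h₁, ← Category.assoc, hq.zero, comp_zero])
  have : IsIso u := ⟨v, by rw [← cancel_epi q, reassoc_of% hu, hv, Category.comp_id],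
    by rw [← cancel_epi g', reassoc_of% hv, hu, Category.comp_id]⟩
  have hc : c = m ≫ u := by rw [← cancel_epi g, ← h₂, ← reassoc_of% sq.w, hu]
  rw [hc]
  exact hE.inflation_comp _ _ hm.inflation (hE.inflation_of_isIso u)

lemma isZero_of_isIso_left (h : IsConflation E f g) [IsIso f] : IsZero Z := by
  have := hE.epi h
  rw [IsZero.iff_id_eq_zero, ← cancel_epi g, ← cancel_epi f]
  simp [h.zero]

end

end IsExactCategory

end

/-! ### Inflations concentrated in one place -/

section

variable {C : Type u} [Category.{v} C] [Preadditive C] {E : ObjectProperty (ShortComplex C)}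
  {n : ℕ}

namespace Inf

/-- The `n`-inflation `X` is isomorphic to one of the form `0 ⟶ ⋯ ⟶ 0 ⟶ M ⟶ M ⟶ ⋯ ⟶ M` with
first copy of `M` at the place `s`. -/
structure IsConcentrated (s : Fin n) (X : Inf E n) : Prop where
  isZero : ∀ i < s, IsZero (X.obj.obj i)
  isIso : ∀ i (h : s ≤ i), IsIso (X.obj.map (homOfLE h))

namespace IsConcentrated

variable {s : Fin n} {X : Inf E n}

/-- Together with `exists_hom`, this is the adjunction between `θ^s` and evaluation at `s`. -/
lemma hom_ext (hX : X.IsConcentrated s) {Y : Inf E n} {f g : X ⟶ Y}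
    (h : f.hom.app s = g.hom.app s) : f = g := by
  apply ObjectProperty.hom_ext
  ext i
  by_cases hi : s ≤ i
  · have := hX.isIso i hi
    rw [← cancel_epi (X.obj.map (homOfLE hi)), f.hom.naturality, g.hom.naturality, h]
  · exact (hX.isZero i (not_le.1 hi)).eq_of_src _ _

lemma exists_hom (hX : X.IsConcentrated s) {Y : Inf E n} (a : X.obj.obj s ⟶ Y.obj.obj s) :
    ∃ f : X ⟶ Y, f.hom.app s = a := by
  have hX' := hX.isIso
  refine ⟨ObjectProperty.homMk
    { app i := if h : s ≤ i then inv (X.obj.map (homOfLE h)) ≫ a ≫ Y.obj.map (homOfLE h) else 0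
      naturality i j u := ?_ }, ?_⟩
  · by_cases hi : s ≤ i
    · have hj := hi.trans (leOfHom u)
      rw [dif_pos hi, dif_pos hj, ← cancel_epi (X.obj.map (homOfLE hi)), ← X.obj.map_comp_assoc,
        Subsingleton.elim (homOfLE hi ≫ u) (homOfLE hj)]
      simp only [IsIso.hom_inv_id_assoc, Category.assoc, ← Y.obj.map_comp]
      rfl
    · exact (hX.isZero i (not_le.1 hi)).eq_of_src _ _
  · change dite _ _ _ = a
    rw [dif_pos le_rfl, Subsingleton.elim (homOfLE _) (𝟙 s)]
    simp

lemma nonempty_iso (hX : X.IsConcentrated s) {Y : Inf E n} (hY : Y.IsConcentrated s)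
    (e : X.obj.obj s ≅ Y.obj.obj s) : Nonempty (X ≅ Y) := by
  obtain ⟨f, hf⟩ := hX.exists_hom e.hom
  obtain ⟨g, hg⟩ := hY.exists_hom e.inv
  exact ⟨⟨f, g, hX.hom_ext (by simp [hf, hg]), hY.hom_ext (by simp [hf, hg])⟩⟩

lemma nonempty_iso_obj (hX : X.IsConcentrated s) {i : Fin n} (hi : s ≤ i) :
    Nonempty (X.obj.obj s ≅ X.obj.obj i) :=
  have := hX.isIso i hi
  ⟨asIso (X.obj.map (homOfLE hi))⟩

lemma isConflation (hE : IsExactCategory E) (hX : X.IsConcentrated s) {Y Z : Inf E n}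
    (hY : Y.IsConcentrated s) (hZ : Z.IsConcentrated s) {f : X ⟶ Y} {g : Y ⟶ Z}
    (h : IsConflation E (f.hom.app s) (g.hom.app s)) :
    IsConflation (Inf.conflation E n) f g := by
  refine Inf.isConflation_iff.2 fun i => ?_
  by_cases hi : s ≤ i
  · have := hX.isIso i hi
    have := hY.isIso i hi
    have := hZ.isIso i hi
    exact hE.conflation_of_iso (asIso (X.obj.map (homOfLE hi))) (asIso (Y.obj.map (homOfLE hi)))
      (asIso (Z.obj.map (homOfLE hi))) (by simp) (by simp) h
  · have hi := not_le.1 hi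
    exact hE.conflation_of_isZero _ _ (hX.isZero i hi) (hY.isZero i hi) (hZ.isZero i hi)

end IsConcentrated

lemma theta_isConcentrated (hE : IsExactCategory E) (s : Fin n) (P : C) :
    (theta hE s P).IsConcentrated s where
  isZero i hi := by
    have := hE.hasZeroObject
    change IsZero (ite _ _ _)
    rw [if_neg (not_le.2 hi)]
    exact isZero_zero C
  isIso i hi := by
    have := hE.hasZeroObject
    have h : (thetaSeq s P).map (homOfLE hi) = eqToHom (by simp [thetaSeq, hi]) := dif_pos le_rfl
    change IsIso ((thetaSeq s P).map (homOfLE hi))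
    rw [h]
    infer_instance

lemma nonempty_theta_iso (hE : IsExactCategory E) (s : Fin n) (P : C) :
    Nonempty ((theta hE s P).obj.obj s ≅ P) :=
  ⟨eqToIso (if_pos le_rfl)⟩

lemma exists_isConcentrated (hE : IsExactCategory E) (s : Fin n) (P : C) :
    ∃ X : Inf E n, X.IsConcentrated s ∧ Nonempty (X.obj.obj s ≅ P) :=
  ⟨_, theta_isConcentrated hE s P, nonempty_theta_iso hE s P⟩

/-! ### Truncation and dévissage. -/

/-- An `n`-inflation that vanishes before the place `s` has a subobject concentrated at `s` with
quotient vanishing up to `s`. -/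
lemma exists_truncation (hE : IsExactCategory E) (X : Inf E n) (s : Fin n)
    (hX : ∀ i < s, IsZero (X.obj.obj i)) :
    ∃ (X₁ X₂ : Inf E n) (i : X₁ ⟶ X) (p : X ⟶ X₂), IsConflation (Inf.conflation E n) i p ∧
      X₁.IsConcentrated s ∧ IsIso (i.hom.app s) ∧ ∀ j ≤ s, IsZero (X₂.obj.obj j) := by
  -- The subobject is `j ↦ X^{min(j,s)}`: equal to `X` up to `s`, constant from `s` on.
  have hmono : Monotone fun j : Fin n => min j s := fun a b h => min_le_min_right s h
  let T : Fin n ⥤ C := hmono.functor ⋙ X.obj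
  have hT : ∀ {i j : Fin n} (u : i ⟶ j), IsInflation E (T.map u) :=
    fun u => hE.isInflation_map X _
  let X₁ : Inf E n := ⟨T, fun i hi => hT _⟩
  let ι : T ⟶ X.obj :=
    { app j := X.obj.map (homOfLE (min_le_left j s))
      naturality i j u := by
        change X.obj.map _ ≫ X.obj.map _ = X.obj.map _ ≫ X.obj.map _
        rw [← X.obj.map_comp, ← X.obj.map_comp]
        rfl }
  obtain ⟨Z, p, h⟩ := hE.exists_functor_cokernel ι fun j => hE.isInflation_map X _
  have h' := isConflation_functor_iff.1 h
  have hiso : ∀ {i j : Fin n} (u : i ⟶ j), j ≤ i → IsIso (X.obj.map u) := fun {i j} u hji =>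
    ⟨X.obj.map (homOfLE hji), by
      rw [← X.obj.map_comp, ← X.obj.map_id]
      rfl, by
      rw [← X.obj.map_comp, ← X.obj.map_id]
      rfl⟩
  have hι : ∀ j ≤ s, IsIso (ι.app j) := fun j hj => hiso _ (le_min le_rfl hj)
  have hZ : ∀ j ≤ s, IsZero (Z.obj j) := fun j hj =>
    have := hι j hj
    hE.isZero_of_isIso_left (h' j)
  -- Up to `s` the source is zero. From `s` on the subobject is constant, so the transition map of
  -- the quotient is an inflation by Noether's isomorphism.
  have hZ' : isNInflation E n Z := fun i hi => by
    by_cases his : (⟨i, Nat.lt_of_succ_lt hi⟩ : Fin n) ≤ s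
    · exact hE.inflation_of_isZero (hZ _ his) _
    · have his := (not_le.1 his).le
      have : IsIso (T.map (homOfLE (Nat.le_succ i) :
          (⟨i, Nat.lt_of_succ_lt hi⟩ : Fin n) ⟶ ⟨i + 1, hi⟩)) :=
        hiso _ (le_min ((min_le_right _ _).trans his) (min_le_right _ _))
      exact hE.inflation_of_isIso_left (h' _) (h' _) (ι.naturality _).symm (p.naturality _)
        (X.property i hi)
  refine ⟨X₁, ⟨Z, hZ'⟩, ObjectProperty.homMk ι, ObjectProperty.homMk p,
    Inf.isConflation_iff.2 h', ⟨fun i hi => ?_, fun i hi => ?_⟩, hι s le_rfl, hZ⟩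
  · have := hι i hi.le
    exact (hX i hi).of_iso (asIso (ι.app i))
  · exact hiso _ (le_min (min_le_right _ _) (min_le_right _ _))

lemma isZero_of_app (X : Inf E n) (h : ∀ i, IsZero (X.obj.obj i)) : IsZero X := by
  rw [IsZero.iff_id_eq_zero]
  apply ObjectProperty.hom_ext
  ext i
  exact (h i).eq_of_src _ _

lemma isZero_app {X : Inf E n} (h : IsZero X) (i : Fin n) :
    IsZero (X.obj.obj i) := by
  rw [IsZero.iff_id_eq_zero] at h ⊢
  exact congrArg (fun f => f.hom.app i) h

/-- Dévissage: a property of `n`-inflations with components in `R` holds if it holds for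
concentrated ones and is closed under extensions. -/
lemma devissage_of (hE : IsExactCategory E) {R : ObjectProperty C}
    (hR : ∀ ⦃X Y Z : C⦄ (f : X ⟶ Y) (g : Y ⟶ Z), IsConflation E f g → R X → R Y → R Z)
    (hR₀ : ∀ X, IsZero X → R X) {Q : ObjectProperty (Inf E n)} (zero : ∀ X, IsZero X → Q X)
    (concentrated : ∀ (s : Fin n) (X : Inf E n), X.IsConcentrated s → R (X.obj.obj s) → Q X)
    (extension : ∀ ⦃X Y Z : Inf E n⦄ (f : X ⟶ Y) (g : Y ⟶ Z),
      IsConflation (Inf.conflation E n) f g → (∀ i, R (X.obj.obj i)) → (∀ i, R (Y.obj.obj i)) →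
      (∀ i, R (Z.obj.obj i)) → Q X → Q Z → Q Y)
    (X : Inf E n) (hX : ∀ i, R (X.obj.obj i)) : Q X := by
  -- Induction on `k`, where only the last `k` components may be nonzero; for `k = n` this is no
  -- condition.
  suffices ∀ (k : ℕ) (X : Inf E n), (∀ i, R (X.obj.obj i)) →
      (∀ i : Fin n, i + k < n → IsZero (X.obj.obj i)) → Q X from
    this n X hX fun i hi => by omega
  intro k
  induction k with
  | zero => exact fun X _ hX => zero X (X.isZero_of_app fun i => hX i i.2)
  | succ k ih =>
    intro X hRX hX
    by_cases hk : k < n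
    -- The first of the last `k + 1` places; truncating there leaves a quotient living on the last
    -- `k`.
    · obtain ⟨s, hs⟩ : ∃ s : Fin n, s.val = n - (k + 1) := ⟨⟨n - (k + 1), by omega⟩, rfl⟩
      obtain ⟨X₁, X₂, i, p, h, h₁, h₂, h₃⟩ := exists_truncation hE X s
        (fun i hi => hX i (by rw [Fin.lt_def] at hi; omega))
      -- Closure under isomorphisms follows from `hR` applied to `0 ⟶ A ⟶ B`.
      have hRiso : ∀ {A B : C}, (A ≅ B) → R A → R B := fun e hA => by
        obtain ⟨Z, hZ⟩ := hE.hasZeroObject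
        exact hR _ _ (hE.conflation_zero_isIso (0 : Z ⟶ _) hZ e.hom) (hR₀ Z hZ) hA
      have hRs := hRiso (asIso (i.hom.app s)).symm (hRX _)
      have hR₁ : ∀ j, R (X₁.obj.obj j) := fun j => by
        by_cases hj : s ≤ j
        · exact hRiso (h₁.nonempty_iso_obj hj).some hRs
        · exact hR₀ _ (h₁.isZero j (not_le.1 hj))
      have hR₂ : ∀ j, R (X₂.obj.obj j) := fun j =>
        hR _ _ (Inf.isConflation_iff.1 h j) (hR₁ j) (hRX j)
      exact extension i p h hR₁ hRX hR₂ (concentrated _ _ h₁ hRs)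
        (ih X₂ hR₂ fun j hj => h₃ j (by rw [Fin.le_def]; omega))
    · exact ih X hRX fun i hi => by omega

lemma devissage (hE : IsExactCategory E) {Q : ObjectProperty (Inf E n)}
    (zero : ∀ X, IsZero X → Q X) (concentrated : ∀ (s : Fin n) (X : Inf E n),
      X.IsConcentrated s → Q X)
    (extension : ∀ ⦃X Y Z : Inf E n⦄ (f : X ⟶ Y) (g : Y ⟶ Z),
      IsConflation (Inf.conflation E n) f g → Q X → Q Z → Q Y) (X : Inf E n) : Q X :=
  devissage_of hE (R := ⊤) (fun _ _ _ _ _ _ _ _ => trivial) (fun _ _ => trivial) zero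
    (fun s X hX _ => concentrated s X hX) (fun _ _ _ f g h _ _ _ => extension f g h) X
    fun _ => trivial

end Inf

end

end FrobQuot
namespace FrobQuot

universe v u

/-! ### The Frobenius category of `n`-inflations -/

section

variable {C : Type u} [Category.{v} C] [Preadditive C] {E : ObjectProperty (ShortComplex C)}

/-- As `X` is also injective, the conflation splits and `Z` is a summand of `Y`. This keeps
truncation quotients inside the objects with projective components. -/
lemma IsFrobeniusCategory.proj_cokernel (hE : IsFrobeniusCategory E) ⦃X Y Z : C⦄ (f : X ⟶ Y)
    (g : Y ⟶ Z) (h : IsConflation E f g) (hX : proj E X) (hY : proj E Y) : proj E Z := by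
  obtain ⟨s, hs⟩ := hE.exists_section_of_inj h ((hE.proj_iff_inj X).1 hX)
  exact proj_of_retract hY s g hs

variable {n : ℕ}

namespace Inf

/-- An `n`-inflation with injective components is injective. -/
lemma inj_of_app (hE : IsExactCategory E) {W : Inf E n} (hW : ∀ i, inj E (W.obj.obj i)) :
    inj (Inf.conflation E n) W := by
  rintro X Y f ⟨Z, g, h⟩
  have hE' := hE.inf n
  -- The dévissage runs over the cokernel `Z` of the inflation; `X` and `Y` vary because the
  -- extension step replaces the conflation.
  refine devissage hE (Q := fun Z => ∀ ⦃X Y : Inf E n⦄ (f : X ⟶ Y) (g : Y ⟶ Z),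
    IsConflation (Inf.conflation E n) f g → ∀ a : X ⟶ W, ∃ k : Y ⟶ W, f ≫ k = a)
    ?_ ?_ ?_ Z f g h
  · intro Z hZ X Y f g h a
    obtain ⟨t, ht⟩ := hE'.lift h (𝟙 Y) (hZ.eq_of_tgt _ _)
    have := hE'.mono h
    exact ⟨t ≫ a, by
      have : f ≫ t = 𝟙 X := by rw [← cancel_mono f, Category.assoc, ht]; simp
      rw [reassoc_of% this]⟩
  · intro s Z hZ X Y f g h a
    obtain ⟨V, b, y, q, sq, hq, h'⟩ := hE'.exists_pushout h a
    -- The pushed-out conflation splits at the place `s`; as `Z` is concentrated there, this section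
    -- extends to a global one.
    obtain ⟨t, ht⟩ := hE.exists_section_of_inj (Inf.isConflation_iff.1 h' s) (hW s)
    obtain ⟨t, rfl⟩ := hZ.exists_hom t
    have ht : t ≫ q = 𝟙 Z := hZ.hom_ext ht
    have := hE'.mono h'
    obtain ⟨k, hk⟩ := hE'.lift h' (b - g ≫ t) (by simp [ht, hq])
    refine ⟨k, ?_⟩
    rw [← cancel_mono y, Category.assoc, hk, Preadditive.comp_sub, reassoc_of% h.zero, zero_comp,
      sub_zero, sq.w]
  · intro Z₁ Z Z₂ i p hZ h₁ h₂ X Y f g h a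
    -- Extend `a` first to the preimage `Y₁` of `Z₁`, with cokernel `Z₁`, and then to `Y`, with
    -- cokernel `Z₂`.
    obtain ⟨Y₁, j, d, x, -, hx, hxd, hj⟩ := hE'.exists_kernel_comp h hZ
    obtain ⟨k, hk⟩ := h₁ x d hxd a
    obtain ⟨l, hl⟩ := h₂ j _ hj k
    exact ⟨l, by rw [← hx, Category.assoc, hl, hk]⟩

/-- Over a Frobenius category, an `n`-inflation with projective components is projective. -/
lemma proj_of_app (hE : IsFrobeniusCategory E) (W : Inf E n) (hW : ∀ i, proj E (W.obj.obj i)) :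
    proj (Inf.conflation E n) W := by
  refine devissage_of hE.toIsExactCategory (R := proj E) hE.proj_cokernel
    (fun X hX => proj_of_isZero hX) (fun X hX => proj_of_isZero hX) ?_ ?_ W hW
  · intro s X hX hXs Y Z g hg a
    obtain ⟨k, hk⟩ := hXs _ (isDeflation_app hg s) (a.hom.app s)
    obtain ⟨k, rfl⟩ := hX.exists_hom k
    exact ⟨k, hX.hom_ext hk⟩
  · intro X Y Z f g h _ _ _ hX hZ
    exact (hE.toIsExactCategory.inf n).proj_extension h hX hZ

lemma IsConcentrated.proj_app {s : Fin n} {X : Inf E n} (hX : X.IsConcentrated s)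
    (h : proj E (X.obj.obj s)) (i : Fin n) : proj E (X.obj.obj i) := by
  by_cases hi : s ≤ i
  · exact proj_of_iso (hX.nonempty_iso_obj hi).some h
  · exact proj_of_isZero (hX.isZero i (not_le.1 hi))

/-- For `X` concentrated at `s`, apply `θ^s` to a projective cover conflation of its `s`-th
component, minimality not being required; the horseshoe handles extensions. -/
lemma exists_deflation (hE : IsFrobeniusCategory E) (X : Inf E n) :
    ∃ (W : Inf E n) (p : W ⟶ X), (∀ i, proj E (W.obj.obj i)) ∧
      IsDeflation (Inf.conflation E n) p := by
  have hE₁ := hE.toIsExactCategory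
  have hE' := hE₁.inf n
  refine devissage hE₁ (Q := fun X => ∃ (W : Inf E n) (p : W ⟶ X),
    (∀ i, proj E (W.obj.obj i)) ∧ IsDeflation (Inf.conflation E n) p) ?_ ?_ ?_ X
  · exact fun X hX => ⟨X, 𝟙 X, fun i => proj_of_isZero (isZero_app hX i), hE'.deflation_id X⟩
  · intro s X hX
    obtain ⟨P, p, hP, hp⟩ := hE.enough_proj (X.obj.obj s)
    obtain ⟨K, k, h⟩ := hp.exists_conflation
    obtain ⟨TP, hTP, ⟨eP⟩⟩ := exists_isConcentrated hE₁ s P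
    obtain ⟨TK, hTK, ⟨eK⟩⟩ := exists_isConcentrated hE₁ s K
    obtain ⟨p', hp'⟩ := hTP.exists_hom (Y := X) (eP.hom ≫ p)
    obtain ⟨k', hk'⟩ := hTK.exists_hom (Y := TP) (eK.hom ≫ k ≫ eP.inv)
    refine ⟨TP, p', hTP.proj_app (proj_of_iso eP.symm hP),
      (hTK.isConflation hE₁ hTP hX (f := k') ?_).deflation⟩
    rw [hk', hp']
    exact hE₁.conflation_of_iso eK.symm eP.symm (Iso.refl _) (by simp) (by simp) h
  · rintro X Y Z f g h ⟨W₁, w₁, hW₁, h₁⟩ ⟨W₂, w₂, hW₂, h₂⟩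
    obtain ⟨W, i, q, w, hiq, hw⟩ :=
      hE'.exists_horseshoe_deflation h h₁ h₂ (proj_of_app hE W₂ hW₂)
    exact ⟨W, w, fun j => hE₁.proj_extension (isConflation_iff.1 hiq j) (hW₁ j) (hW₂ j), hw⟩

lemma exists_inflation (hE : IsFrobeniusCategory E) (X : Inf E n) :
    ∃ (W : Inf E n) (i : X ⟶ W), (∀ i, proj E (W.obj.obj i)) ∧
      IsInflation (Inf.conflation E n) i := by
  have hE₁ := hE.toIsExactCategory
  have hE' := hE₁.inf n
  refine devissage hE₁ (Q := fun X => ∃ (W : Inf E n) (i : X ⟶ W),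
    (∀ i, proj E (W.obj.obj i)) ∧ IsInflation (Inf.conflation E n) i) ?_ ?_ ?_ X
  · exact fun X hX => ⟨X, 𝟙 X, fun i => proj_of_isZero (isZero_app hX i), hE'.inflation_id X⟩
  · intro s X hX
    obtain ⟨P, p, hP, hp⟩ := hE.enough_inj (X.obj.obj s)
    obtain ⟨K, k, h⟩ := hp.exists_conflation
    obtain ⟨TP, hTP, ⟨eP⟩⟩ := exists_isConcentrated hE₁ s P
    obtain ⟨TK, hTK, ⟨eK⟩⟩ := exists_isConcentrated hE₁ s K
    obtain ⟨p', hp'⟩ := hX.exists_hom (Y := TP) (p ≫ eP.inv)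
    obtain ⟨k', hk'⟩ := hTP.exists_hom (Y := TK) (eP.hom ≫ k ≫ eK.inv)
    refine ⟨TP, p', hTP.proj_app (proj_of_iso eP.symm ((hE.proj_iff_inj P).2 hP)),
      (hX.isConflation hE₁ hTP hTK (g := k') ?_).inflation⟩
    rw [hk', hp']
    exact hE₁.conflation_of_iso (Iso.refl _) eP.symm eK.symm (by simp) (by simp) h
  · rintro X Y Z f g h ⟨W₁, w₁, hW₁, h₁⟩ ⟨W₂, w₂, hW₂, h₂⟩
    obtain ⟨W, i, q, w, hiq, hw⟩ := hE'.exists_horseshoe_inflation h h₁ h₂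
      (inj_of_app hE₁ fun i => (hE.proj_iff_inj _).1 (hW₁ i))
    exact ⟨W, w, fun j => hE₁.proj_extension (isConflation_iff.1 hiq j) (hW₁ j) (hW₂ j), hw⟩

/-- A projective object is a summand of one with projective components. The same argument with
inflations gives `inj_iff`, so both classes coincide. -/
lemma proj_iff (hE : IsFrobeniusCategory E) (X : Inf E n) :
    proj (Inf.conflation E n) X ↔ ∀ i, proj E (X.obj.obj i) := by
  refine ⟨fun hX i => ?_, proj_of_app hE X⟩
  obtain ⟨W, p, hW, hp⟩ := exists_deflation hE X
  obtain ⟨s, hs⟩ := hX p hp (𝟙 X)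
  exact proj_of_retract (hW i) (s.hom.app i) (p.hom.app i) (congrArg (fun f => f.hom.app i) hs)

lemma inj_iff (hE : IsFrobeniusCategory E) (X : Inf E n) :
    inj (Inf.conflation E n) X ↔ ∀ i, proj E (X.obj.obj i) := by
  refine ⟨fun hX i => ?_,
    fun h => inj_of_app hE.toIsExactCategory fun i => (hE.proj_iff_inj _).1 (h i)⟩
  obtain ⟨W, j, hW, hj⟩ := exists_inflation hE X
  obtain ⟨r, hr⟩ := hX j hj (𝟙 X)
  exact proj_of_retract (hW i) (j.hom.app i) (r.hom.app i) (congrArg (fun f => f.hom.app i) hr)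

end Inf

/-- The category of `n`-inflations in a Frobenius category is Frobenius. -/
lemma IsFrobeniusCategory.inf (hE : IsFrobeniusCategory E) (n : ℕ) :
    IsFrobeniusCategory (Inf.conflation E n) where
  toIsExactCategory := hE.toIsExactCategory.inf n
  enough_proj X := by
    obtain ⟨W, p, hW, hp⟩ := Inf.exists_deflation hE X
    exact ⟨W, p, (Inf.proj_iff hE W).2 hW, hp⟩
  enough_inj X := by
    obtain ⟨W, i, hW, hi⟩ := Inf.exists_inflation hE X
    exact ⟨W, i, (Inf.inj_iff hE W).2 hW, hi⟩
  proj_iff_inj X := (Inf.proj_iff hE X).trans (Inf.inj_iff hE X).symm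

end

end FrobQuot
namespace FrobQuot

universe v u v' u'

/-! ### Frobenius quotients up to equivalence -/

section

variable {C : Type u} [Category.{v} C] [Preadditive C]
  {D : Type u'} [Category.{v'} D] [Preadditive D]
  {E : ObjectProperty (ShortComplex C)} {E' : ObjectProperty (ShortComplex D)}

/-- The functor `F` is, up to equivalence, the quotient by the ideal of its essential kernel,
which consists of projective objects. -/
structure IsIdealQuotient (E : ObjectProperty (ShortComplex C))
    (E' : ObjectProperty (ShortComplex D)) (F : C ⥤ D) [F.Additive] : Prop where
  exact : IsExactFunctor E E' F
  full : F.Full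
  essSurj : F.EssSurj
  factorsThrough : ∀ ⦃X Y : C⦄ (f : X ⟶ Y), F.map f = 0 → FactorsThrough (essKer F) f
  proj_of_essKer : ∀ X, essKer F X → proj E X
  exists_conflation : ∀ T, E' T → ∃ S, E S ∧ Nonempty (S.map F ≅ T)

lemma IsExactFunctor.map_conflation {F : C ⥤ D} [F.Additive] (hF : IsExactFunctor E E' F)
    {X Y Z : C} {f : X ⟶ Y} {g : Y ⟶ Z} (h : IsConflation E f g) :
    IsConflation E' (F.map f) (F.map g) :=
  ⟨by rw [← F.map_comp, h.zero, F.map_zero], hF _ h.2⟩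

lemma map_eq_zero_of_factorsThrough {F : C ⥤ D} [F.Additive] {X Y : C} {f : X ⟶ Y}
    (h : FactorsThrough (essKer F) f) : F.map f = 0 := by
  obtain ⟨W, a, b, hW, rfl⟩ := h
  rw [F.map_comp, IsZero.eq_of_tgt hW (F.map a) 0, zero_comp]

lemma essKer_isAdditiveSubcategory (hE : IsExactCategory E) (F : C ⥤ D) [F.Additive] :
    IsAdditiveSubcategory (essKer F) where
  zero := by
    obtain ⟨Z, hZ⟩ := hE.hasZeroObject
    exact ⟨Z, hZ, F.map_isZero hZ⟩
  sum X Y hX hY := by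
    have := hE.hasBinaryBiproducts
    refine ⟨_, ⟨BinaryBiproduct.isBilimit X Y⟩, ?_⟩
    change IsZero (F.obj (X ⊞ Y))
    rw [IsZero.iff_id_eq_zero, ← F.map_id, ← biprod.total, F.map_add, F.map_comp, F.map_comp,
      IsZero.eq_of_tgt hX (F.map biprod.fst) 0, IsZero.eq_of_tgt hY (F.map biprod.snd) 0]
    simp

lemma essKer_of_id_eq_zero {F : C ⥤ D} [F.Additive] {X : C} (h : F.map (𝟙 X) = 0) :
    essKer F X := by
  change IsZero _
  rwa [IsZero.iff_id_eq_zero, ← F.map_id]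

lemma essKer_cokernel {F : C ⥤ D} [F.Additive] (hE' : IsExactCategory E')
    (hF : IsExactFunctor E E' F) ⦃X Y Z : C⦄ (f : X ⟶ Y) (g : Y ⟶ Z) (h : IsConflation E f g)
    (_ : essKer F X) (hY : essKer F Y) : essKer F Z := by
  have := hE'.epi (hF.map_conflation h)
  change IsZero _
  rw [IsZero.iff_id_eq_zero, ← cancel_epi (F.map g)]
  exact IsZero.eq_of_src hY _ _

/-- A Frobenius quotient is the quotient by the ideal of its essential kernel. -/
lemma IsFrobeniusQuotient.isIdealQuotient {F : C ⥤ D} [F.Additive]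
    (hF : IsFrobeniusQuotient E E' F) : IsIdealQuotient E E' F := by
  have hexact := hF.exact
  obtain ⟨𝓕, _, G, _, hrem, rfl, hG, H, _, ⟨e₁⟩, ⟨e₂⟩, hH⟩ := hF
  have : G.IsEquivalence := (CategoryTheory.Equivalence.mk G H e₁.symm e₂).isEquivalence_functor
  have hzero : ∀ {X Y : C} (f : X ⟶ Y), (factorFunctor 𝓕 ⋙ G).map f = 0 ↔
      FactorsThrough 𝓕 f := by
    intro X Y f
    have h := Quotient.functor_map_eq_iff (idealRel 𝓕) f 0
    rw [idealRel, sub_zero] at h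
    rw [← h, Functor.comp_map, (factorFunctor 𝓕).map_zero, G.map_eq_zero_iff]
  refine ⟨hexact, inferInstance, inferInstance, fun X Y f hf => ?_, fun X hX => ?_,
    fun T hT => ?_⟩
  -- The subcategory `𝓕` lies in the essential kernel, whose objects are conversely retracts of
  -- objects of `𝓕`; hence both define the same ideal.
  · obtain ⟨W, a, b, hW, h⟩ := (hzero f).1 hf
    exact ⟨W, a, b, essKer_of_id_eq_zero ((hzero _).2 ⟨W, 𝟙 W, 𝟙 W, hW, by simp⟩), h⟩
  · obtain ⟨W, a, b, hW, h⟩ := (hzero (𝟙 X)).1 (IsZero.eq_of_src hX _ _)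
    exact proj_of_retract (hrem.le_proj W hW) a b h
  · obtain ⟨S, hS, ⟨e⟩⟩ := hH T hT
    exact ⟨S, hS, ⟨G.mapShortComplex.mapIso e ≪≫
      ShortComplex.isoMk (e₂.app _) (e₂.app _) (e₂.app _)
        (e₂.hom.naturality T.f).symm (e₂.hom.naturality T.g).symm⟩⟩

/-- The quotient by the ideal of the essential kernel is a Frobenius quotient, as soon as the
essential kernel consists of projective objects and conflations lift. -/
lemma IsIdealQuotient.isFrobeniusQuotient {F : C ⥤ D} [F.Additive] (hE : IsExactCategory E)
    (hE' : IsExactCategory E') (hF : IsIdealQuotient E E' F) : IsFrobeniusQuotient E E' F := by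
  have := essKer_isAdditiveSubcategory hE F
  have := hF.full
  have := hF.essSurj
  let G : FactorCategory (essKer F) ⥤ D := CategoryTheory.Quotient.lift (idealRel (essKer F)) F
    fun X Y f g h => by
      rw [← sub_eq_zero, ← F.map_sub]
      exact map_eq_zero_of_factorsThrough h
  have hG : ∀ {X Y : C} (f : X ⟶ Y), G.map ((factorFunctor (essKer F)).map f) = F.map f :=
    fun f => Quotient.lift_map_functor_map _ _ _ f
  have hsurj : ∀ {X Y : FactorCategory (essKer F)} (f : X ⟶ Y),
      ∃ f' : X.as ⟶ Y.as, (factorFunctor (essKer F)).map f' = f :=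
    fun f => (factorFunctor (essKer F)).map_surjective f
  have : G.Additive := ⟨fun {X Y f g} => by
    obtain ⟨f, rfl⟩ := hsurj f
    obtain ⟨g, rfl⟩ := hsurj g
    have h := F.map_add (f := f) (g := g)
    rw [← hG, Functor.map_add] at h
    exact h⟩
  have : G.Faithful := ⟨fun {X Y} f g h => by
    obtain ⟨f, rfl⟩ := hsurj f
    obtain ⟨g, rfl⟩ := hsurj g
    refine CategoryTheory.Quotient.sound _ (hF.factorsThrough _ ?_)
    rw [F.map_sub, sub_eq_zero]
    exact h⟩
  have : G.Full := ⟨fun {X Y} f => by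
    obtain ⟨f', hf'⟩ := F.map_surjective (X := X.as) (Y := Y.as) f
    exact ⟨(factorFunctor (essKer F)).map f', hf'⟩⟩
  have : G.EssSurj := ⟨fun Y => ⟨⟨F.objPreimage Y⟩, ⟨F.objObjPreimageIso Y⟩⟩⟩
  have : G.IsEquivalence := { }
  have : G.asEquivalence.functor.Additive := inferInstanceAs G.Additive
  have : G.inv.Additive := inferInstanceAs G.asEquivalence.inverse.Additive
  have hGE : IsExactFunctor (factorConflation E (essKer F)) E' G := by
    rintro T ⟨S, hS, ⟨e⟩⟩
    exact hE'.of_iso (G.mapShortComplex.mapIso e) (hF.exact S hS)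
  refine ⟨essKer F, inferInstance, G, inferInstance, ⟨hF.proj_of_essKer, fun S hS => ?_⟩,
    Quotient.lift_spec _ _ _, hGE, G.inv, inferInstance, ⟨G.asEquivalence.unitIso.symm⟩,
    ⟨G.asEquivalence.counitIso⟩, ?_⟩
  -- Removability: the image under the fully faithful `G` is a conflation, and such functors reflect
  -- kernel-cokernel pairs.
  · exact .of_map G (hE'.kernelCokernel _ (hF.exact S hS))
  · intro T hT
    obtain ⟨S, hS, ⟨e⟩⟩ := hF.exists_conflation T hT
    let η := G.asEquivalence.unitIso
    exact ⟨S, hS, ⟨ShortComplex.isoMk (S₂ := ((S.map (factorFunctor (essKer F))).map G).map G.inv)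
      (η.app _) (η.app _) (η.app _)
      (η.hom.naturality ((factorFunctor (essKer F)).map S.f)).symm
      (η.hom.naturality ((factorFunctor (essKer F)).map S.g)).symm ≪≫
      G.inv.mapShortComplex.mapIso e⟩⟩

/-- Up to isomorphism the deflation comes from `C` and, by fullness, so does the map to be lifted;
the lift is then found in `C`. -/
lemma IsIdealQuotient.map_proj {F : C ⥤ D} [F.Additive] (hF : IsIdealQuotient E E' F) {P : C}
    (hP : proj E P) : proj E' (F.obj P) := by
  rintro Y Z g ⟨X, f, w, hT⟩ h
  have := hF.full
  obtain ⟨S, hS, ⟨e⟩⟩ := hF.exists_conflation _ hT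
  obtain ⟨h', hh'⟩ := F.map_surjective (Y := S.X₃) (h ≫ e.inv.τ₃)
  obtain ⟨k, hk⟩ := hP S.g ⟨_, _, S.zero, hS⟩ h'
  let e₂ : F.obj S.X₂ ⟶ Y := e.hom.τ₂
  let e₃ : F.obj S.X₃ ⟶ Z := e.hom.τ₃
  let i₃ : Z ⟶ F.obj S.X₃ := e.inv.τ₃
  have hg : e₂ ≫ g = F.map S.g ≫ e₃ := e.hom.comm₂₃
  have he : i₃ ≫ e₃ = 𝟙 Z := congrArg (·.τ₃) e.inv_hom_id
  refine ⟨F.map k ≫ e₂, ?_⟩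
  have hh' : F.map h' = h ≫ i₃ := hh'
  rw [Category.assoc, hg, ← F.map_comp_assoc, hk, hh', Category.assoc, he, Category.comp_id]

/-! ### Lifting morphisms and conflations along an exact functor. -/

/-- If an exact functor is given by factoring out the ideal of its essential kernel, then the
objects on which it is full are closed under extensions. -/
lemma IsExactFunctor.map_surjective_of_extension {F : C ⥤ D} [F.Additive]
    (hE : IsExactCategory E) (hE' : IsExactCategory E') (hF : IsExactFunctor E E' F)
    (hfac : ∀ ⦃X Y : C⦄ (f : X ⟶ Y), F.map f = 0 → FactorsThrough (essKer F) f)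
    (hproj : ∀ X, essKer F X → proj E X) {X₁ X X₂ : C} {i : X₁ ⟶ X} {p : X ⟶ X₂}
    (h : IsConflation E i p)
    (h₁ : ∀ Y : C, Function.Surjective (F.map : (X₁ ⟶ Y) → _))
    (h₂ : ∀ Y : C, Function.Surjective (F.map : (X₂ ⟶ Y) → _)) (Y : C) :
    Function.Surjective (F.map : (X ⟶ Y) → _) := by
  intro g
  obtain ⟨a, ha⟩ := h₁ Y (F.map i ≫ g)
  obtain ⟨V, x, y, q, sq, hxq, h'⟩ := hE.exists_pushout h a
  have hFh := hF.map_conflation h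
  have hFh' := hF.map_conflation h'
  have := hE'.epi hFh
  have := hE'.mono hFh'
  -- A preimage of `g` amounts to a section of `q`: the map `m` is the section of `F.map q` that `g`
  -- determines.
  obtain ⟨m, hm⟩ := hE'.desc hFh (F.map x - g ≫ F.map y) (by
    rw [Preadditive.comp_sub, ← F.map_comp, sq.w, F.map_comp, ha, Category.assoc, sub_self])
  have hmq : m ≫ F.map q = 𝟙 _ := by
    rw [← cancel_epi (F.map p), reassoc_of% hm, Preadditive.sub_comp, Category.assoc,
      hFh'.zero, comp_zero, sub_zero, ← F.map_comp, hxq, Category.comp_id]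
  obtain ⟨t, ht⟩ := h₂ V m
  -- The lift `t` of `m` is a section of `q` only modulo the ideal. Projectivity of `K` lifts the
  -- error along `q`, and `t - b ≫ c'` is a true section with the same image.
  obtain ⟨K, b, c, hK, hbc⟩ := hfac (t ≫ q - 𝟙 X₂) (by
    rw [F.map_sub, F.map_comp, ht, hmq, F.map_id, sub_self])
  obtain ⟨c', hc'⟩ := hproj K hK q h'.deflation c
  obtain ⟨f, hf⟩ := hE.lift h' (x - p ≫ (t - b ≫ c')) (by
    simp [hxq, hc', hbc])
  refine ⟨f, ?_⟩
  rw [← cancel_mono (F.map y), ← F.map_comp, hf, F.map_sub, F.map_comp, F.map_sub, ht,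
    map_eq_zero_of_factorsThrough (f := b ≫ c') ⟨K, b, c', hK, rfl⟩, sub_zero, hm]
  abel

/-- A conflation lifts along a full exact functor if its ends do and the right one admits a
deflation from an object sent to a projective one. -/
lemma IsExactFunctor.exists_conflation_of_ends {F : C ⥤ D} [F.Additive] [F.Full]
    (hE : IsExactCategory E) (hE' : IsExactCategory E') (hF : IsExactFunctor E E' F) {X Y Z : D}
    {f : X ⟶ Y} {g : Y ⟶ Z} (h : IsConflation E' f g) {X₁ X₃ P : C} (eX : F.obj X₁ ≅ X)
    (eZ : F.obj X₃ ≅ Z) {p : P ⟶ X₃} (hp : IsDeflation E p) (hP : proj E' (F.obj P)) :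
    ∃ (X₂ : C) (f' : X₁ ⟶ X₂) (g' : X₂ ⟶ X₃) (e : F.obj X₂ ≅ Y), IsConflation E f' g' ∧
      eX.hom ≫ f = F.map f' ≫ e.hom ∧ e.hom ≫ g = F.map g' ≫ eZ.hom := by
  obtain ⟨Ω, k, hk⟩ := hp.exists_conflation
  obtain ⟨l, hl⟩ := hP g h.deflation (F.map p ≫ eZ.hom)
  obtain ⟨m, hm⟩ := hE'.lift h (F.map k ≫ l)
    (by rw [Category.assoc, hl, ← F.map_comp_assoc, hk.zero, F.map_zero, zero_comp])
  -- The given conflation is the pushout of the image of `Ω ⟶ P ⟶ X₃` along `m`, the classifying map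
  -- of the extension. Lift this map and form the pushout in `C`.
  obtain ⟨m', hm'⟩ := F.map_surjective (m ≫ eX.inv)
  obtain ⟨X₂, b, f', g', sq, hg', h'⟩ := hE.exists_pushout hk m'
  obtain ⟨V, c, f₂, g₂, sq₂, hg₂, h₂⟩ := hE'.exists_pushout (hF.map_conflation hk) m
  obtain ⟨s, hs, hs'⟩ := sq₂.exists_desc (F.map b) (eX.inv ≫ F.map f')
    (by rw [← F.map_comp, sq.w, F.map_comp, hm', Category.assoc])
  obtain ⟨t, ht, ht'⟩ := sq₂.exists_desc l f hm.symm
  have h₃ : IsConflation E' (eX.inv ≫ F.map f') (F.map g') :=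
    hE'.conflation_of_iso eX (Iso.refl _) (Iso.refl _) (by simp) (by simp) (hF.map_conflation h')
  have h₄ : IsConflation E' f (g ≫ eZ.inv) :=
    hE'.conflation_of_iso (Iso.refl _) (Iso.refl _) eZ.symm (by simp) (by simp) h
  -- The short five lemma identifies the pushout `V` in `D` with both `F.obj X₂` and `Y`, so
  -- preservation of pushouts by `F` need not be assumed.
  have : IsIso s := hE'.isIso_of_conflations h₂ h₃ s hs' (sq₂.hom_ext
    (by rw [reassoc_of% hs, ← F.map_comp, hg', hg₂])
    (by rw [reassoc_of% hs', ← F.map_comp, h'.zero, F.map_zero, comp_zero, h₂.zero]))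
  have hts : t ≫ g ≫ eZ.inv = g₂ := sq₂.hom_ext
    (by rw [reassoc_of% ht, reassoc_of% hl, eZ.hom_inv_id, Category.comp_id, hg₂])
    (by rw [reassoc_of% ht', reassoc_of% h.zero, zero_comp, h₂.zero])
  have : IsIso t := hE'.isIso_of_conflations h₂ h₄ t ht' hts
  have hsg : s ≫ F.map g' = g₂ := sq₂.hom_ext
    (by rw [reassoc_of% hs, ← F.map_comp, hg', hg₂])
    (by rw [reassoc_of% hs', ← F.map_comp, h'.zero, F.map_zero, comp_zero, h₂.zero])
  refine ⟨X₂, f', g', (asIso s).symm ≪≫ asIso t, h', ?_, ?_⟩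
  · rw [← cancel_epi eX.inv, eX.inv_hom_id_assoc, ← reassoc_of% hs']
    simp [ht']
  · rw [← cancel_mono eZ.inv, ← cancel_epi s]
    simp [hts, hsg]

end

/-! ### Functors induced on categories of `n`-inflations -/

section

variable {C : Type u} [Category.{v} C] [Preadditive C]
  {D : Type u'} [Category.{v'} D] [Preadditive D]
  {E : ObjectProperty (ShortComplex C)} {E' : ObjectProperty (ShortComplex D)}
  {F : C ⥤ D} [F.Additive] {n : ℕ}

lemma infFunctor_exact (hF : IsExactFunctor E E' F) (n : ℕ) :
    IsExactFunctor (Inf.conflation E n) (Inf.conflation E' n) (infFunctor F hF n) :=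
  fun _ hS i => hF _ (hS i)

lemma essKer_infFunctor_iff (hF : IsExactFunctor E E' F) {X : Inf E n} :
    essKer (infFunctor F hF n) X ↔ ∀ i, essKer F (X.obj.obj i) :=
  ⟨fun h i => Inf.isZero_app h i, fun h => Inf.isZero_of_app _ h⟩

lemma Inf.IsConcentrated.map (hF : IsExactFunctor E E' F) {s : Fin n} {X : Inf E n}
    (hX : X.IsConcentrated s) : ((infFunctor F hF n).obj X).IsConcentrated s where
  isZero i hi := F.map_isZero (hX.isZero i hi)
  isIso i hi :=
    have := hX.isIso i hi
    inferInstanceAs (IsIso (F.map (X.obj.map (homOfLE hi))))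

lemma Inf.IsConcentrated.essKer_infFunctor (hF : IsExactFunctor E E' F) {s : Fin n}
    {X : Inf E n} (hX : X.IsConcentrated s) (h : essKer F (X.obj.obj s)) :
    essKer (infFunctor F hF n) X := by
  refine (essKer_infFunctor_iff hF).2 fun i => ?_
  by_cases hi : s ≤ i
  · exact IsZero.of_iso h (F.mapIso (hX.nonempty_iso_obj hi).some.symm)
  · exact F.map_isZero (hX.isZero i (not_le.1 hi))

namespace IsIdealQuotient

variable (hE : IsFrobeniusCategory E) (hE' : IsFrobeniusCategory E')
  (hF : IsIdealQuotient E E' F)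
include hE hF

lemma inf_proj_of_essKer (X : Inf E n) (hX : essKer (infFunctor F hF.exact n) X) :
    proj (Inf.conflation E n) X :=
  Inf.proj_of_app hE X fun i => hF.proj_of_essKer _ ((essKer_infFunctor_iff hF.exact).1 hX i)

include hE'

lemma inf_factorsThrough ⦃X Y : Inf E n⦄ (f : X ⟶ Y) (hf : (infFunctor F hF.exact n).map f = 0) :
    FactorsThrough (essKer (infFunctor F hF.exact n)) f := by
  have hEn := hE.inf n
  have hEn' := hE'.inf n
  have := essKer_isAdditiveSubcategory hEn.toIsExactCategory (infFunctor F hF.exact n)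
  refine Inf.devissage hE.toIsExactCategory (Q := fun X => ∀ ⦃Y : Inf E n⦄ (f : X ⟶ Y),
    (infFunctor F hF.exact n).map f = 0 → FactorsThrough (essKer (infFunctor F hF.exact n)) f)
    ?_ ?_ ?_ X f hf
  · intro X hX Y f _
    exact ⟨X, 𝟙 X, f, Functor.map_isZero _ hX, by simp⟩
  · intro s X hX Y f hf
    obtain ⟨K, a, b, hK, hab⟩ := hF.factorsThrough (f.hom.app s)
      (congrArg (fun f => f.hom.app s) hf)
    obtain ⟨T, hT, ⟨e⟩⟩ := Inf.exists_isConcentrated hE.toIsExactCategory s K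
    obtain ⟨a', ha'⟩ := hX.exists_hom (Y := T) (a ≫ e.inv)
    obtain ⟨b', hb'⟩ := hT.exists_hom (Y := Y) (e.hom ≫ b)
    exact ⟨T, a', b', hT.essKer_infFunctor hF.exact (IsZero.of_iso hK (F.mapIso e)),
      hX.hom_ext (by simp [ha', hb', hab])⟩
  · intro X₁ X X₂ i p h h₁ h₂ Y f hf
    obtain ⟨K, u, v, hK, huv⟩ := h₁ (i ≫ f) (by rw [Functor.map_comp, hf, comp_zero])
    -- Injectivity of `K` extends the factorization from `X₁` to `X`. The difference `f - u' ≫ v`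
    -- vanishes on `X₁`, so it descends to `X₂`, where the hypothesis on `X₂` applies.
    obtain ⟨u', hu'⟩ := (hEn.proj_iff_inj K).1 (hF.inf_proj_of_essKer hE K hK) i h.inflation u
    have huv' : FactorsThrough (essKer (infFunctor F hF.exact n)) (u' ≫ v) := ⟨K, u', v, hK, rfl⟩
    obtain ⟨f', hf'⟩ := hEn.desc h (f - u' ≫ v) (by simp [reassoc_of% hu', huv])
    have := hEn'.epi ((infFunctor_exact hF.exact n).map_conflation h)
    obtain ⟨W, a, b, hW, hab⟩ := h₂ f' (by
      rw [← cancel_epi ((infFunctor F hF.exact n).map p), ← Functor.map_comp, hf',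
        Functor.map_sub, hf, map_eq_zero_of_factorsThrough huv']
      simp)
    have hpf : FactorsThrough (essKer (infFunctor F hF.exact n)) (p ≫ f') :=
      ⟨W, p ≫ a, b, hW, by rw [Category.assoc, hab]⟩
    have := hpf.add huv'
    rwa [hf', sub_add_cancel] at this

lemma inf_full : (infFunctor F hF.exact n).Full := by
  have hEn := hE.inf n
  have hEn' := hE'.inf n
  have := hF.full
  have hexact := infFunctor_exact hF.exact n
  suffices ∀ X Y : Inf E n, Function.Surjective
      ((infFunctor F hF.exact n).map : (X ⟶ Y) → _) from ⟨fun {X Y} => this X Y⟩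
  intro X
  refine Inf.devissage hE.toIsExactCategory (Q := fun X => ∀ Y : Inf E n, Function.Surjective
      ((infFunctor F hF.exact n).map : (X ⟶ Y) → _)) ?_ ?_ ?_ X
  · exact fun X hX Y g => ⟨0, (Functor.map_isZero (infFunctor F hF.exact n) hX).eq_of_src _ _⟩
  · intro s X hX Y g
    obtain ⟨a, ha⟩ := F.map_surjective (g.hom.app s)
    obtain ⟨f, hf⟩ := hX.exists_hom a
    refine ⟨f, (hX.map hF.exact).hom_ext ?_⟩
    rw [← ha, ← hf]
    rfl
  · intro X₁ X X₂ i p h h₁ h₂ Y g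
    exact hexact.map_surjective_of_extension hEn.toIsExactCategory hEn'.toIsExactCategory
      (hF.inf_factorsThrough hE hE') (hF.inf_proj_of_essKer hE) h h₁ h₂ Y g

lemma inf_exists_conflation_of_ends {X Y Z : Inf E' n} {f : X ⟶ Y} {g : Y ⟶ Z}
    (h : IsConflation (Inf.conflation E' n) f g) {X₁ X₃ : Inf E n}
    (eX : (infFunctor F hF.exact n).obj X₁ ≅ X) (eZ : (infFunctor F hF.exact n).obj X₃ ≅ Z) :
    ∃ (X₂ : Inf E n) (f' : X₁ ⟶ X₂) (g' : X₂ ⟶ X₃) (e : (infFunctor F hF.exact n).obj X₂ ≅ Y),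
      IsConflation (Inf.conflation E n) f' g' ∧
      eX.hom ≫ f = (infFunctor F hF.exact n).map f' ≫ e.hom ∧
      e.hom ≫ g = (infFunctor F hF.exact n).map g' ≫ eZ.hom := by
  have := hF.inf_full hE hE' (n := n)
  obtain ⟨P, p, hP, hp⟩ := Inf.exists_deflation hE X₃
  exact (infFunctor_exact hF.exact n).exists_conflation_of_ends
    (hE.toIsExactCategory.inf n) (hE'.toIsExactCategory.inf n) h eX eZ hp
    (Inf.proj_of_app hE' _ fun i => hF.map_proj (hP i))

/-- Dévissage runs in the target category; an extension of objects in the image is in the image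
since its conflation lifts with prescribed ends. -/
lemma inf_essSurj : (infFunctor F hF.exact n).EssSurj := by
  have := hF.essSurj
  refine ⟨fun Z => Inf.devissage hE'.toIsExactCategory
    (Q := (infFunctor F hF.exact n).essImage) ?_ ?_ ?_ Z⟩
  · intro Z hZ
    obtain ⟨X, hX⟩ := (hE.toIsExactCategory.inf n).hasZeroObject
    exact ⟨X, ⟨(Functor.map_isZero (infFunctor F hF.exact n) hX).iso hZ⟩⟩
  · intro s Z hZ
    obtain ⟨X, hX, ⟨e⟩⟩ := Inf.exists_isConcentrated hE.toIsExactCategory s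
      (F.objPreimage (Z.obj.obj s))
    exact ⟨X, (hX.map hF.exact).nonempty_iso hZ (F.mapIso e ≪≫ F.objObjPreimageIso _)⟩
  · rintro X Y Z f g h ⟨X₁, ⟨e₁⟩⟩ ⟨X₃, ⟨e₃⟩⟩
    obtain ⟨X₂, -, -, e, -⟩ := hF.inf_exists_conflation_of_ends hE hE' h e₁ e₃
    exact ⟨X₂, ⟨e⟩⟩

/-- The functor induced on categories of `n`-inflations is again the quotient by the ideal of its
essential kernel. -/
lemma inf (n : ℕ) : IsIdealQuotient (Inf.conflation E n) (Inf.conflation E' n)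
    (infFunctor F hF.exact n) where
  exact := infFunctor_exact hF.exact n
  full := hF.inf_full hE hE'
  essSurj := hF.inf_essSurj hE hE'
  factorsThrough := hF.inf_factorsThrough hE hE'
  proj_of_essKer := hF.inf_proj_of_essKer hE
  exists_conflation T hT := by
    have := hF.inf_essSurj hE hE' (n := n)
    let L := infFunctor F hF.exact n
    obtain ⟨X₂, f, g, e, h, h₁, h₂⟩ := hF.inf_exists_conflation_of_ends hE hE'
      (show IsConflation _ T.f T.g from ⟨T.zero, hT⟩)
      (L.objObjPreimageIso T.X₁) (L.objObjPreimageIso T.X₃)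
    exact ⟨_, h.2, ⟨ShortComplex.isoMk (L.objObjPreimageIso T.X₁) e (L.objObjPreimageIso T.X₃)
      h₁ h₂⟩⟩

end IsIdealQuotient

end

/-! ### The essential kernel -/

section

variable {C : Type u} [Category.{v} C] [Preadditive C]

lemma addClosure_of_splitting {S : ObjectProperty C} {X Y Z : C} (f : X ⟶ Y) (r : Y ⟶ X)
    (s : Z ⟶ Y) (g : Y ⟶ Z) (hfr : f ≫ r = 𝟙 X) (hsg : s ≫ g = 𝟙 Z) (hfg : f ≫ g = 0)
    (hsr : s ≫ r = 0) (h : r ≫ f + g ≫ s = 𝟙 Y) (hX : addClosure S X) (hZ : addClosure S Z) :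
    addClosure S Y :=
  .sum ⟨Y, r, g, f, s, hfr, hfg, hsr, hsg⟩ (isBinaryBilimitOfTotal _ h) hX hZ

/-- `Y` is a direct sum of `X` and a zero object; closure under isomorphisms is thus a consequence
of closure under sums. -/
lemma addClosure_of_iso {S : ObjectProperty C} {X Y : C} (e : X ≅ Y) (hX : addClosure S X)
    (hzero : ∃ Z : C, IsZero Z) : addClosure S Y := by
  obtain ⟨Z, hZ⟩ := hzero
  exact addClosure_of_splitting e.hom e.inv (0 : Z ⟶ Y) 0 (by simp) (hZ.eq_of_src _ _) (by simp)
    (by simp) (by simp) hX (.zero Z hZ)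

variable {D : Type u'} [Category.{v'} D] [Preadditive D]
  {E : ObjectProperty (ShortComplex C)} {E' : ObjectProperty (ShortComplex D)}
  {F : C ⥤ D} [F.Additive]

/-- An essential kernel is closed under direct sums and direct summands. -/
lemma essKer_of_addClosure {S : ObjectProperty C} (hS : ∀ X, S X → essKer F X) {X : C}
    (hX : addClosure S X) : essKer F X := by
  induction hX with
  | of X h => exact hS X h
  | zero X h => exact F.map_isZero h
  | sum b hb _ _ hX hY =>
    apply essKer_of_id_eq_zero
    rw [← IsBilimit.binary_total hb, F.map_add, F.map_comp, F.map_comp,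
      IsZero.eq_of_tgt hX (F.map b.fst) 0, IsZero.eq_of_tgt hY (F.map b.snd) 0]
    simp
  | summand b hb _ h =>
    apply essKer_of_id_eq_zero
    rw [← b.inl_fst, F.map_comp, IsZero.eq_of_tgt h (F.map b.inl) 0, zero_comp]

/-- The essential kernel of the functor induced on `n`-inflations. -/
lemma IsIdealQuotient.essKer_infFunctor (hE : IsFrobeniusCategory E)
    (hE' : IsFrobeniusCategory E') (hF : IsIdealQuotient E E' F) (n : ℕ) :
    essKer (infFunctor F hF.exact n) = addClosure (fun X => ∃ (j : Fin n) (P : C),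
      essKer F P ∧ X = theta hE.toIsExactCategory j P) := by
  have hE₁ := hE.toIsExactCategory
  have hEn := hE₁.inf n
  ext X
  refine ⟨fun hX => ?_, fun hX => essKer_of_addClosure ?_ hX⟩
  -- Restricting to components in `essKer F` keeps every subquotient in the kernel.
  · refine Inf.devissage_of hE₁ (R := essKer F)
      (essKer_cokernel hE'.toIsExactCategory hF.exact) (fun X hX => F.map_isZero hX)
      (fun X hX => .zero X hX) ?_ ?_ X ((essKer_infFunctor_iff hF.exact).1 hX)
    · intro s X hX hXs
      obtain ⟨e⟩ := Inf.nonempty_theta_iso hE₁ s (X.obj.obj s)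
      obtain ⟨e'⟩ := (Inf.theta_isConcentrated hE₁ s _).nonempty_iso hX e
      exact addClosure_of_iso e' (.of _ ⟨s, _, hXs, rfl⟩) hEn.hasZeroObject.zero
    · intro X Y Z f g h _ _ hZ hQX hQZ
      -- The right end has projective components, hence is projective, and the extension is a direct
      -- sum.
      obtain ⟨s, hs⟩ := Inf.proj_of_app hE Z (fun i => hF.proj_of_essKer _ (hZ i)) g h.deflation
        (𝟙 Z)
      obtain ⟨r, hr, hsr, hrs⟩ := hEn.splitting_of_section h hs
      exact addClosure_of_splitting f r s g hr hs h.zero hsr hrs hQX hQZ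
  · rintro _ ⟨j, P, hP, rfl⟩
    exact (Inf.theta_isConcentrated hE₁ j P).essKer_infFunctor hF.exact
      (IsZero.of_iso hP (F.mapIso (Inf.nonempty_theta_iso hE₁ j P).some))

end

end FrobQuot

theorem theorem3 {A : Type u₁} [CategoryTheory.Category.{v₁} A] [CategoryTheory.Preadditive A]
    {B : Type u₂} [CategoryTheory.Category.{v₂} B] [CategoryTheory.Preadditive B]
    (EA : ObjectProperty (ShortComplex A)) (EB : ObjectProperty (ShortComplex B))
    (hA : FrobQuot.IsFrobeniusCategory EA) (hB : FrobQuot.IsFrobeniusCategory EB)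
    (F : A ⥤ B) [F.Additive] (hF : FrobQuot.IsFrobeniusQuotient EA EB F)
    (n : ℕ) (hn : 1 ≤ n) :
    FrobQuot.IsFrobeniusCategory (FrobQuot.Inf.conflation EA n) ∧
    FrobQuot.IsFrobeniusCategory (FrobQuot.Inf.conflation EB n) ∧
    FrobQuot.IsFrobeniusQuotient (FrobQuot.Inf.conflation EA n) (FrobQuot.Inf.conflation EB n)
      (FrobQuot.infFunctor F hF.exact n) ∧
    FrobQuot.essKer (FrobQuot.infFunctor F hF.exact n) =
      FrobQuot.addClosure (fun X => ∃ (j : Fin n) (P : A), FrobQuot.essKer F P ∧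
        X = FrobQuot.theta hA.toIsExactCategory j P) := by
  have hQ := hF.isIdealQuotient
  exact ⟨hA.inf n, hB.inf n, (hQ.inf hA hB n).isFrobeniusQuotient
    (hA.toIsExactCategory.inf n) (hB.toIsExactCategory.inf n), hQ.essKer_infFunctor hA hB n⟩
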